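/- Conventions. All filtrations are by subspaces (by subcomplexes, for complexes). A filtration of a complex is biregular if it is finite in each degree. $D^+(\mathbb C)$ is the derived category of bounded below complexes of $\mathbb C$-vector spaces. $D^+F(k)$ is the filtered derived category: bounded below complexes of $k$-vector spaces with a biregular filtration, localized at the filtered quasi-isomorphisms (the filtered morphisms that induce quasi-isomorphisms on all graded pieces). No vector space is assumed to be finite-dimensional. An infinite Hodge structure of weight $n$ is a $\mathbb Q$-vector space $V$ with a finite decreasing filtration $F$ on $V_{\mathbb C}=V\otimes_{\mathbb Q}\mathbb C$ such that $\mathrm{gr}_F^p\,\mathrm{gr}_{\bar F}^q(V_{\mathbb C})=0$ for $p+q\neq n$. An infinite mixed Hodge structure is a $\mathbb Q$-vector space $V$ with a finite increasing filtration $W$ on $V$ and a finite decreasing filtration $F$ on $V_{\mathbb C}$ such that, for every $n$, $F$ induces an infinite Hodge structure of weight $n$ on $\mathrm{gr}^W_n V$. An infinite Hodge complex of weight $n$ consists of a bounded below complex $K$ of $\mathbb Q$-vector spaces, a bounded below complex $K_{\mathbb C}$ of $\mathbb C$-vector spaces with a decreasing biregular filtration $F$, and an isomorphism $K\otimes_{\mathbb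 Q}\mathbb C\simeq K_{\mathbb C}$ in $D^+(\mathbb C)$, such that (a) the differential of $K_{\mathbb C}$ is strictly compatible with $F$ (that is, the spectral sequence of $(K_{\mathbb C},F)$ degenerates at $E_1$), and (b) for every $k$ the filtration induced by $F$ on $H^k(K_{\mathbb C})\simeq H^k(K)\otimes\mathbb C$ defines an infinite Hodge structure of weight $n+k$ on $H^k(K)$. An infinite mixed Hodge complex consists of a complex $(K,W)$ in $D^+F(\mathbb Q)$ with $W$ increasing, a bounded below complex $K_{\mathbb C}$ of $\mathbb C$-vector spaces with an increasing biregular filtration $W$ and a decreasing biregular filtration $F$, and an isomorphism $\alpha:(K,W)\otimes_{\mathbb Q}\mathbb C\simeq (K_{\mathbb C},W)$ in $D^+F(\mathbb C)$, such that for every $n$ the complexes $\mathrm{gr}^W_nK$ and $(\mathrm{gr}^W_nK_{\mathbb C},F)$, with the isomorphism $\mathrm{gr}^W_n\alpha$, form an infinite Hodge complex of weight $n$. Put $\mathrm{Dec}(W)_nK^i=W_{n-i}K^i$. It induces on $H^i(K)$ the filtration whose $n$-th step consists of the classes of the cocycles in $\mathrm{Dec}(W)_nK^i$. The filtration $F$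 induces a filtration on $H^i(K_{\mathbb C})\simeq H^i(K)\otimes\mathbb C$. Theorem. Let $(K,W,\alpha,K_{\mathbb C},W,F)$ be an infinite mixed Hodge complex. Then for every $i$ the filtrations induced by $\mathrm{Dec}(W)$ and $F$ form an infinite mixed Hodge structure on $H^i(K)$. Moreover, the weight spectral sequence of $(K,W)$, that is, the spectral sequence of the decreasing filtration $p\mapsto W_{-p}K$, with $E_1^{pq}=H^{p+q}(\mathrm{gr}^W_{-p}K)\Rightarrow H^{p+q}(K)$, degenerates at $E_2$: $d_r=0$ for all $r\ge 2$. -/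

import Mathlib

open CategoryTheory
open scoped TensorProduct

universe u

noncomputable section

namespace InfHodge

/-! ## Subquotients and induced filtrations -/

section Subquotients

variable {k : Type*} [Field k] {M N P : Type*} [AddCommGroup M] [Module k M]
  [AddCommGroup N] [Module k N] [AddCommGroup P] [Module k P]

/-- The subquotient `A / (A ∩ B)` of a module. -/
abbrev Subq (A B : Submodule k M) : Type _ := ↥A ⧸ B.comap A.subtype

/-- The submodule induced by `F` on the subquotient `A / (A ∩ B)`: the image of `A ∩ F`. -/
def Subq.induced (A B F : Submodule k M) : Submodule k (Subq A B) :=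
  (F.comap A.subtype).map (Submodule.mkQ (B.comap A.subtype))

/-- The map induced by a linear map on subquotients. -/
def Subq.map (f : M →ₗ[k] N) {A B : Submodule k M} {A' B' : Submodule k N}
    (hA : A ≤ A'.comap f) (hB : B ≤ B'.comap f) : Subq A B →ₗ[k] Subq A' B' :=
  Submodule.mapQ _ _ (f.restrict (p := A) (q := A') hA) (fun _ hx => hB hx)

@[simp] lemma Subq.map_mk (f : M →ₗ[k] N) {A B : Submodule k M} {A' B' : Submodule k N}
    (hA : A ≤ A'.comap f) (hB : B ≤ B'.comap f) (x : A) :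
    Subq.map f hA hB (Submodule.Quotient.mk x) = Submodule.Quotient.mk ⟨f x, hA x.2⟩ := rfl

end Subquotients

section BaseChange

variable {M : Type*} [AddCommGroup M] [Module ℚ M]

/-- The natural comparison map `ℂ ⊗ (A / (A ∩ B)) → A' / (A' ∩ B')`, `c ⊗ [a] ↦ c • [1 ⊗ a]`,
where `A'` and `B'` are subspaces of `ℂ ⊗ M` which contain `ℂ ⊗ A` and `ℂ ⊗ B`. -/
def Subq.complexMap (A B : Submodule ℚ M) (A' B' : Submodule ℂ (ℂ ⊗[ℚ] M))
    (hA : A.baseChange ℂ ≤ A') (hB : B.baseChange ℂ ≤ B') :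
    ℂ ⊗[ℚ] Subq A B →ₗ[ℂ] Subq A' B' :=
  LinearMap.liftBaseChange ℂ
    (Submodule.liftQ (B.comap A.subtype)
      ({ toFun := fun a => Submodule.Quotient.mk
          ⟨1 ⊗ₜ[ℚ] (a : M), hA (Submodule.tmul_mem_baseChange_of_mem _ a.2)⟩
         map_add' := fun a b => by
          rw [← Submodule.Quotient.mk_add]
          congr 1
          ext
          simp [TensorProduct.tmul_add]
         map_smul' := fun c a => by
          rw [RingHom.id_apply, ← Submodule.Quotient.mk_smul]
          congr 1
          ext
          simp } : A →ₗ[ℚ] Subq A' B')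
      (fun a ha => by
        rw [LinearMap.mem_ker]
        exact (Submodule.Quotient.mk_eq_zero _).2
          (hB (Submodule.tmul_mem_baseChange_of_mem _ ha))))

@[simp] lemma Subq.complexMap_tmul (A B : Submodule ℚ M) (A' B' : Submodule ℂ (ℂ ⊗[ℚ] M))
    (hA : A.baseChange ℂ ≤ A') (hB : B.baseChange ℂ ≤ B') (c : ℂ) (a : A) :
    Subq.complexMap A B A' B' hA hB (c ⊗ₜ Submodule.Quotient.mk a) =
      c • Submodule.Quotient.mk
        ⟨1 ⊗ₜ[ℚ] (a : M), hA (Submodule.tmul_mem_baseChange_of_mem _ a.2)⟩ := by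
  simp only [complexMap, LinearMap.liftBaseChange_tmul]
  rfl

lemma Subq.complexMap_bijective (A B : Submodule ℚ M) (A' B' : Submodule ℂ (ℂ ⊗[ℚ] M))
    (hA : A.baseChange ℂ = A') (hB : B.baseChange ℂ = B') (hBA : B ≤ A) :
    Function.Bijective (Subq.complexMap A B A' B' hA.le hB.le) := by
  subst hA hB
  have key : ∀ t : ℂ ⊗[ℚ] A, Subq.complexMap A B _ _ le_rfl le_rfl
      ((Submodule.mkQ (B.comap A.subtype)).baseChange ℂ t) =
        Submodule.Quotient.mk (A.toBaseChange ℂ t) := by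
    intro t
    induction t with
    | zero => simp
    | add x y hx hy => rw [map_add, map_add, hx, hy, map_add, Submodule.Quotient.mk_add]
    | tmul c a =>
      rw [LinearMap.baseChange_tmul, Submodule.mkQ_apply, Subq.complexMap_tmul,
        ← Submodule.Quotient.mk_smul]
      congr 1
      ext
      simp [TensorProduct.smul_tmul']
  have hs : Function.Surjective ((Submodule.mkQ (B.comap A.subtype)).baseChange ℂ) :=
    LinearMap.baseChange_surjective _ (Submodule.mkQ_surjective _)
  constructor
  · rw [← LinearMap.ker_eq_bot, LinearMap.ker_eq_bot']
    intro t ht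
    obtain ⟨s, rfl⟩ := hs t
    rw [key, Submodule.Quotient.mk_eq_zero] at ht
    obtain ⟨b, hb⟩ := B.toBaseChange_surjective ℂ ⟨_, ht⟩
    have hb' : (B.subtype.baseChange ℂ) b = (A.subtype.baseChange ℂ) s := congrArg Subtype.val hb
    have hj : A.subtype.baseChange ℂ ((Submodule.inclusion hBA).baseChange ℂ b) =
        (A.subtype.baseChange ℂ) s := by
      rw [← hb', ← LinearMap.comp_apply, ← LinearMap.baseChange_comp]
      rfl
    have hinj : Function.Injective (A.subtype.baseChange ℂ) :=
      Module.Flat.lTensor_preserves_injective_linearMap (M := ℂ) A.subtype A.injective_subtype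
    rw [← hinj hj, ← LinearMap.comp_apply, ← LinearMap.baseChange_comp]
    have : (Submodule.mkQ (B.comap A.subtype)) ∘ₗ Submodule.inclusion hBA = 0 := by
      ext x
      exact (Submodule.Quotient.mk_eq_zero _).2 x.2
    rw [this]
    simp
  · intro y
    obtain ⟨y, rfl⟩ := Submodule.Quotient.mk_surjective _ y
    obtain ⟨s, rfl⟩ := A.toBaseChange_surjective ℂ y
    exact ⟨_, key s⟩

lemma ker_baseChange_complex {N : Type*} [AddCommGroup N] [Module ℚ N] (f : M →ₗ[ℚ] N) :
    (LinearMap.ker f).baseChange ℂ = LinearMap.ker (f.baseChange ℂ) := by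
  ext x
  have h := Module.Flat.ker_lTensor_eq (M := ℂ) (S := ℚ) f
  have h1 : x ∈ LinearMap.ker (f.baseChange ℂ) ↔ x ∈ LinearMap.ker
    (TensorProduct.AlgebraTensorModule.lTensor ℚ ℂ f) := Iff.rfl
  rw [h1, h]
  rfl

lemma range_baseChange_complex {N : Type*} [AddCommGroup N] [Module ℚ N] (f : M →ₗ[ℚ] N) :
    (LinearMap.range f).baseChange ℂ = LinearMap.range (f.baseChange ℂ) := by
  apply le_antisymm
  · rw [Submodule.baseChange_eq_span, Submodule.span_le]
    rintro _ ⟨_, ⟨y, rfl⟩, rfl⟩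
    exact ⟨1 ⊗ₜ y, by simp⟩
  · rintro _ ⟨t, rfl⟩
    induction t with
    | zero => simp
    | add x y hx hy => rw [map_add]; exact add_mem hx hy
    | tmul c a => exact Submodule.tmul_mem_baseChange_of_mem _ ⟨a, rfl⟩

end BaseChange

/-! ## Infinite Hodge structures and infinite mixed Hodge structures -/

section Hodge

variable (V : Type*) [AddCommGroup V] [Module ℚ V]

/-- Complex conjugation `c ⊗ v ↦ conj c ⊗ v` on `ℂ ⊗ V`. -/
def conjugation : ℂ ⊗[ℚ] V →ₛₗ[starRingEnd ℂ] ℂ ⊗[ℚ] V where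
  toFun := LinearMap.rTensor V (Complex.conjAe.toLinearMap.restrictScalars ℚ)
  map_add' := map_add _
  map_smul' c x := by
    induction x with
    | zero => simp
    | add x y hx hy => rw [smul_add, map_add, map_add, hx, hy, smul_add]
    | tmul a v => simp [TensorProduct.smul_tmul']

@[simp] lemma conjugation_tmul (c : ℂ) (v : V) :
    conjugation V (c ⊗ₜ v) = (starRingEnd ℂ c) ⊗ₜ v := rfl

variable {V}

/-- The conjugate filtration `q ↦ conj (F q)`; conjugation being an involution, it is written as
a preimage. -/
def conjFiltration (F : ℤ → Submodule ℂ (ℂ ⊗[ℚ] V)) (q : ℤ) : Submodule ℂ (ℂ ⊗[ℚ] V) :=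
  (F q).comap (conjugation V)

/-- Two decreasing filtrations are `n`-opposed if `gr_F^p gr_G^q = 0` for `p + q ≠ n`, where
`gr_G^q` carries the filtration induced by `F`. -/
def IsOpposed {E : Type*} [AddCommGroup E] [Module ℂ E] (n : ℤ) (F G : ℤ → Submodule ℂ E) : Prop :=
  ∀ p q : ℤ, p + q ≠ n → Subsingleton
    (Subq (Subq.induced (G q) (G (q + 1)) (F p)) (Subq.induced (G q) (G (q + 1)) (F (p + 1))))

/-- `F` defines an infinite `ℚ`-Hodge structure of weight `n` on the `ℚ`-vector space `V`
(no finiteness of the dimension is required). -/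
structure IsInfiniteHodgeStructure (n : ℤ) (F : ℤ → Submodule ℂ (ℂ ⊗[ℚ] V)) : Prop where
  antitone : Antitone F
  finite : ∃ a b : ℤ, F a = ⊤ ∧ F b = ⊥
  opposed : IsOpposed n F (conjFiltration F)

/-- The filtration induced by `F` on `ℂ ⊗ gr^W_n V`, a quotient of the subspace `ℂ ⊗ W_n V`. -/
def inducedGr (W : ℤ → Submodule ℚ V) (F : ℤ → Submodule ℂ (ℂ ⊗[ℚ] V)) (n p : ℤ) :
    Submodule ℂ (ℂ ⊗[ℚ] Subq (W n) (W (n - 1))) :=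
  ((F p).comap ((W n).subtype.baseChange ℂ)).map
    ((Submodule.mkQ ((W (n - 1)).comap (W n).subtype)).baseChange ℂ)

/-- `W` (weight filtration) and `F` (Hodge filtration) define an infinite `ℚ`-mixed Hodge
structure on the `ℚ`-vector space `V`. -/
structure IsInfiniteMixedHodgeStructure (W : ℤ → Submodule ℚ V)
    (F : ℤ → Submodule ℂ (ℂ ⊗[ℚ] V)) : Prop where
  weight_monotone : Monotone W
  weight_finite : ∃ a b : ℤ, W a = ⊥ ∧ W b = ⊤
  hodge_antitone : Antitone F
  hodge_finite : ∃ a b : ℤ, F a = ⊤ ∧ F b = ⊥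
  gr : ∀ n : ℤ, IsInfiniteHodgeStructure n (inducedGr W F n)

end Hodge

/-! ## Complexes -/

section Complexes

variable {k : Type} [Field k]

/-- The cocycles of a complex of vector spaces. -/
def cocycles (K : CochainComplex (ModuleCat.{u} k) ℤ) (i : ℤ) : Submodule k (K.X i) :=
  LinearMap.ker (K.d i (i + 1)).hom

/-- The coboundaries of a complex of vector spaces. -/
def coboundaries (K : CochainComplex (ModuleCat.{u} k) ℤ) (i : ℤ) : Submodule k (K.X i) :=
  LinearMap.range (K.d (i - 1) i).hom

/-- The cohomology `H^i(K)` of a complex of vector spaces: cocycles modulo coboundaries. -/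
abbrev Coh (K : CochainComplex (ModuleCat.{u} k) ℤ) (i : ℤ) : Type u :=
  Subq (cocycles K i) (coboundaries K i)

/-- The filtration step induced on `H^i(K)` by a subspace `F` of `K^i`:
the classes of the cocycles which lie in `F`. -/
def Coh.induced (K : CochainComplex (ModuleCat.{u} k) ℤ) (i : ℤ) (F : Submodule k (K.X i)) :
    Submodule k (Coh K i) :=
  Subq.induced (cocycles K i) (coboundaries K i) F

lemma hom_comm {K L : CochainComplex (ModuleCat.{u} k) ℤ} (f : K ⟶ L) (i j : ℤ) (x : K.X i) :
    (L.d i j).hom ((f.f i).hom x) = (f.f j).hom ((K.d i j).hom x) := by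
  have := f.comm i j
  exact congrArg (fun g => g.hom x) this

lemma d_d (K : CochainComplex (ModuleCat.{u} k) ℤ) (i j l : ℤ) (x : K.X i) :
    (K.d j l).hom ((K.d i j).hom x) = 0 := by
  have := K.d_comp_d i j l
  exact congrArg (fun g => g.hom x) this

/-- The map induced in cohomology by a morphism of complexes. -/
def Coh.map {K L : CochainComplex (ModuleCat.{u} k) ℤ} (f : K ⟶ L) (i : ℤ) :
    Coh K i →ₗ[k] Coh L i :=
  Subq.map (f.f i).hom
    (fun x hx => by
      rw [Submodule.mem_comap, cocycles, LinearMap.mem_ker, hom_comm,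
        LinearMap.mem_ker.1 hx, map_zero])
    (by
      rintro _ ⟨y, rfl⟩
      exact ⟨(f.f (i - 1)).hom y, hom_comm f _ _ y⟩)

/-- The functor `H^i`. -/
def cohFunctor (i : ℤ) : CochainComplex (ModuleCat.{u} k) ℤ ⥤ ModuleCat.{u} k where
  obj K := ModuleCat.of k (Coh K i)
  map f := ModuleCat.ofHom (Coh.map f i)
  map_id K := by
    ext x
    rfl
  map_comp f g := by
    ext x
    rfl

/-- The cohomology class of a cocycle. -/
def Coh.mk (K : CochainComplex (ModuleCat.{u} k) ℤ) (i : ℤ) (x : K.X i)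
    (hx : (K.d i (i + 1)).hom x = 0) : Coh K i :=
  Submodule.Quotient.mk (p := (coboundaries K i).comap (cocycles K i).subtype) ⟨x, hx⟩

lemma Coh.mk_surj (K : CochainComplex (ModuleCat.{u} k) ℤ) (i : ℤ) (y : Coh K i) :
    ∃ x hx, y = Coh.mk K i x hx := by
  obtain ⟨⟨x, hx⟩, rfl⟩ := Submodule.Quotient.mk_surjective _ y
  exact ⟨x, hx, rfl⟩

lemma Coh.mk_eq (K : CochainComplex (ModuleCat.{u} k) ℤ) (i : ℤ) (x : K.X i)
    (hx : (K.d i (i + 1)).hom x = 0) (y : K.X i) (hy : (K.d i (i + 1)).hom y = 0) :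
    Coh.mk K i x hx = Coh.mk K i y hy ↔ ∃ z, (K.d (i - 1) i).hom z = x - y :=
  Submodule.Quotient.eq ((coboundaries K i).comap (cocycles K i).subtype)

lemma Coh.mk_eq_zero (K : CochainComplex (ModuleCat.{u} k) ℤ) (i : ℤ) (x : K.X i)
    (hx : (K.d i (i + 1)).hom x = 0) :
    Coh.mk K i x hx = 0 ↔ ∃ z, (K.d (i - 1) i).hom z = x :=
  Submodule.Quotient.mk_eq_zero ((coboundaries K i).comap (cocycles K i).subtype)

/-- Mathlib's quasi-isomorphisms are the morphisms inducing bijections on cohomology. -/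
lemma quasiIsoAt_iff_bijective {K L : CochainComplex (ModuleCat.{u} k) ℤ} (f : K ⟶ L) (i : ℤ) :
    QuasiIsoAt f i ↔ Function.Bijective (Coh.map f i) := by
  have hp : (ComplexShape.up ℤ).prev i = i - 1 := by simp
  have hn : (ComplexShape.up ℤ).next i = i + 1 := by simp
  rw [quasiIsoAt_iff' f (i - 1) i (i + 1) hp hn]
  let S (K : CochainComplex (ModuleCat.{u} k) ℤ) : ShortComplex (ModuleCat.{u} k) :=
    K.sc' (i - 1) i (i + 1)
  have hr (K : CochainComplex (ModuleCat.{u} k) ℤ) :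
      LinearMap.range (S K).moduleCatToCycles =
        (coboundaries K i).comap (cocycles K i).subtype := by
    ext x
    constructor
    · rintro ⟨y, rfl⟩
      exact ⟨y, rfl⟩
    · rintro ⟨y, hy⟩
      exact ⟨y, Subtype.ext hy⟩
  let φK : (S K).moduleCatLeftHomologyData.K ⟶ (S L).moduleCatLeftHomologyData.K :=
    ModuleCat.ofHom ((f.f i).hom.restrict (p := cocycles K i) (q := cocycles L i) (fun x hx => by
      rw [cocycles, LinearMap.mem_ker, hom_comm, LinearMap.mem_ker.1 hx, map_zero]))
  let φ := (HomologicalComplex.shortComplexFunctor' (ModuleCat.{u} k) (ComplexShape.up ℤ)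
    (i - 1) i (i + 1)).map f
  let e (K : CochainComplex (ModuleCat.{u} k) ℤ) :
      (S K).moduleCatLeftHomologyData.H ≃ₗ[k] Coh K i :=
    Submodule.quotEquivOfEq (LinearMap.range (S K).moduleCatToCycles)
      ((coboundaries K i).comap (cocycles K i).subtype) (hr K)
  let φH : (S K).moduleCatLeftHomologyData.H ⟶ (S L).moduleCatLeftHomologyData.H :=
    ModuleCat.ofHom ((e L).symm.toLinearMap ∘ₗ Coh.map f i ∘ₗ (e K).toLinearMap)
  let γ : ShortComplex.LeftHomologyMapData φ (S K).moduleCatLeftHomologyData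
      (S L).moduleCatLeftHomologyData :=
    { φK := φK
      φH := φH
      commi := by ext x; rfl
      commf' := by
        ext x
        apply Subtype.ext
        exact (hom_comm f (i - 1) i x).symm
      commπ := by ext x; rfl }
  have h1 : ShortComplex.QuasiIso φ ↔ IsIso φH := γ.quasiIso_iff
  refine h1.trans ?_
  rw [ConcreteCategory.isIso_iff_bijective]
  change Function.Bijective ((e L).symm ∘ Coh.map f i ∘ (e K)) ↔ _
  rw [Function.Bijective.of_comp_iff' (e L).symm.bijective,
    Function.Bijective.of_comp_iff _ (e K).bijective]

lemma quasiIso_iff_bijective {K L : CochainComplex.Plus (ModuleCat.{u} k)} (f : K ⟶ L) :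
    CochainComplex.Plus.quasiIso _ f ↔ ∀ i, Function.Bijective (Coh.map f.hom i) := by
  simp only [← quasiIsoAt_iff_bijective]
  change QuasiIso f.hom ↔ _
  exact quasiIso_iff _

variable (k) in
/-- The bounded below derived category `D⁺(k)`: bounded below complexes of `k`-vector spaces,
localized at the quasi-isomorphisms. -/
abbrev DPlus : Type _ :=
  (CochainComplex.Plus.quasiIso (ModuleCat.{u} k)).Localization

/-- The localization functor to `D⁺(k)`. -/
abbrev DPlus.Q : CochainComplex.Plus (ModuleCat.{u} k) ⥤ DPlus.{u} k :=
  (CochainComplex.Plus.quasiIso (ModuleCat.{u} k)).Q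

/-- The functor `H^i` on `D⁺(k)`. -/
def DPlus.cohFunctor (i : ℤ) : DPlus.{u} k ⥤ ModuleCat.{u} k :=
  Localization.Construction.lift (CochainComplex.Plus.ι _ ⋙ InfHodge.cohFunctor i)
    (fun _ _ f hf => (ConcreteCategory.isIso_iff_bijective _).2
      ((quasiIso_iff_bijective f).1 hf i))

/-- The isomorphism `H^i(K) ≅ H^i(L)` induced by an isomorphism `K ≅ L` in `D⁺(k)`. -/
def DPlus.cohEquiv {K L : CochainComplex.Plus (ModuleCat.{u} k)}
    (α : DPlus.Q.obj K ≅ DPlus.Q.obj L) (i : ℤ) : Coh K.obj i ≃ₗ[k] Coh L.obj i :=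
  ((DPlus.cohFunctor i).mapIso α : ModuleCat.of k (Coh K.obj i) ≅
    ModuleCat.of k (Coh L.obj i)).toLinearEquiv

/-- `W` is an increasing biregular filtration of the complex `K`: an increasing filtration by
subcomplexes, finite in each degree. -/
structure IsIncreasingBiregular (K : CochainComplex (ModuleCat.{u} k) ℤ)
    (W : ℤ → ∀ i : ℤ, Submodule k (K.X i)) : Prop where
  mono : ∀ i m n, m ≤ n → W m i ≤ W n i
  map_d : ∀ n i j, W n i ≤ (W n j).comap (K.d i j).hom
  finite : ∀ i, ∃ a b, W a i = ⊥ ∧ W b i = ⊤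

/-- `F` is a decreasing biregular filtration of the complex `K`: a decreasing filtration by
subcomplexes, finite in each degree. -/
structure IsDecreasingBiregular (K : CochainComplex (ModuleCat.{u} k) ℤ)
    (F : ℤ → ∀ i : ℤ, Submodule k (K.X i)) : Prop where
  anti : ∀ i p q, p ≤ q → F q i ≤ F p i
  map_d : ∀ p i j, F p i ≤ (F p j).comap (K.d i j).hom
  finite : ∀ i, ∃ a b, F a i = ⊤ ∧ F b i = ⊥

variable (k) in
/-- A bounded below complex of `k`-vector spaces with an increasing biregular filtration. -/
structure FiltCx where
  cx : CochainComplex.Plus (ModuleCat.{u} k)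
  W : ℤ → ∀ i : ℤ, Submodule k (cx.obj.X i)
  biregular : IsIncreasingBiregular cx.obj W

/-- Morphisms of filtered complexes. -/
@[ext]
structure FiltCx.Hom (K L : FiltCx.{u} k) where
  hom : K.cx ⟶ L.cx
  map_le : ∀ n i, K.W n i ≤ (L.W n i).comap (hom.hom.f i).hom

instance : Category (FiltCx.{u} k) where
  Hom := FiltCx.Hom
  id K := ⟨𝟙 _, fun _ _ _ hx => hx⟩
  comp f g := ⟨f.hom ≫ g.hom, fun n i _ hx => g.map_le n i (f.map_le n i hx)⟩

/-- The complex underlying a filtered complex. -/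
def FiltCx.forget : FiltCx.{u} k ⥤ CochainComplex.Plus (ModuleCat.{u} k) where
  obj K := K.cx
  map f := FiltCx.Hom.hom f

/-- The complex `gr^W_n K = W_n K / W_{n-1} K`. -/
def FiltCx.grCx (K : FiltCx.{u} k) (n : ℤ) : CochainComplex (ModuleCat.{u} k) ℤ where
  X i := ModuleCat.of k (Subq (K.W n i) (K.W (n - 1) i))
  d i j := ModuleCat.ofHom (Subq.map (A := K.W n i) (B := K.W (n - 1) i) (A' := K.W n j)
    (B' := K.W (n - 1) j) (K.cx.obj.d i j).hom
    (K.biregular.map_d n i j) (K.biregular.map_d (n - 1) i j))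
  shape i j h := by
    ext x
    refine (Submodule.Quotient.mk_eq_zero
      ((K.W (n - 1) j).comap (K.W n j).subtype)).2 ?_
    have h0 : (K.cx.obj.d i j).hom (x : K.cx.obj.X i) = 0 := by
      rw [K.cx.obj.shape i j h]
      rfl
    change (K.cx.obj.d i j).hom (x : K.cx.obj.X i) ∈ K.W (n - 1) j
    rw [h0]
    exact zero_mem _
  d_comp_d' i j l _ _ := by
    ext x
    refine (Submodule.Quotient.mk_eq_zero
      ((K.W (n - 1) l).comap (K.W n l).subtype)).2 ?_
    change (K.cx.obj.d j l).hom ((K.cx.obj.d i j).hom (x : K.cx.obj.X i)) ∈ K.W (n - 1) l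
    rw [d_d]
    exact zero_mem _

/-- The class in `gr^W_n K^i` of an element of `W_n K^i`. -/
def FiltCx.grMk (K : FiltCx.{u} k) (n i : ℤ) (x : K.cx.obj.X i) (hx : x ∈ K.W n i) :
    (K.grCx n).X i :=
  Submodule.Quotient.mk (p := (K.W (n - 1) i).comap (K.W n i).subtype) ⟨x, hx⟩

lemma FiltCx.grMk_surj (K : FiltCx.{u} k) (n i : ℤ) (y : (K.grCx n).X i) :
    ∃ x hx, y = K.grMk n i x hx := by
  obtain ⟨⟨x, hx⟩, rfl⟩ := Submodule.Quotient.mk_surjective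
    ((K.W (n - 1) i).comap (K.W n i).subtype) y
  exact ⟨x, hx, rfl⟩

lemma FiltCx.grMk_eq (K : FiltCx.{u} k) (n i : ℤ) (x : K.cx.obj.X i) (hx : x ∈ K.W n i)
    (y : K.cx.obj.X i) (hy : y ∈ K.W n i) :
    K.grMk n i x hx = K.grMk n i y hy ↔ x - y ∈ K.W (n - 1) i :=
  Submodule.Quotient.eq ((K.W (n - 1) i).comap (K.W n i).subtype)

lemma FiltCx.grMk_eq_zero (K : FiltCx.{u} k) (n i : ℤ) (x : K.cx.obj.X i) (hx : x ∈ K.W n i) :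
    K.grMk n i x hx = 0 ↔ x ∈ K.W (n - 1) i :=
  Submodule.Quotient.mk_eq_zero ((K.W (n - 1) i).comap (K.W n i).subtype)

lemma FiltCx.d_grMk (K : FiltCx.{u} k) (n i j : ℤ) (x : K.cx.obj.X i) (hx : x ∈ K.W n i) :
    ((K.grCx n).d i j).hom (K.grMk n i x hx) =
      K.grMk n j ((K.cx.obj.d i j).hom x) (K.biregular.map_d n i j hx) := rfl

/-- The morphism `gr^W_n K ⟶ gr^W_n L` induced by a morphism of filtered complexes. -/
def FiltCx.grCxMap {K L : FiltCx.{u} k} (f : K ⟶ L) (n : ℤ) : K.grCx n ⟶ L.grCx n where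
  f i := ModuleCat.ofHom (Subq.map (A := K.W n i) (B := K.W (n - 1) i) (A' := L.W n i)
    (B' := L.W (n - 1) i) ((FiltCx.Hom.hom f).hom.f i).hom
    (FiltCx.Hom.map_le f n i) (FiltCx.Hom.map_le f (n - 1) i))
  comm' i j _ := by
    apply ModuleCat.hom_ext
    apply LinearMap.ext
    intro x
    obtain ⟨x, hx, rfl⟩ := K.grMk_surj n i x
    refine congrArg (Submodule.Quotient.mk
      (p := (L.W (n - 1) j).comap (L.W n j).subtype)) (Subtype.ext ?_)
    exact hom_comm (FiltCx.Hom.hom f).hom i j x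

lemma FiltCx.grCxMap_grMk {K L : FiltCx.{u} k} (f : K ⟶ L) (n i : ℤ) (x : K.cx.obj.X i)
    (hx : x ∈ K.W n i) : ((FiltCx.grCxMap f n).f i).hom (K.grMk n i x hx) =
      L.grMk n i (((FiltCx.Hom.hom f).hom.f i).hom x) (FiltCx.Hom.map_le f n i hx) := rfl

lemma FiltCx.grCx_hom_ext {K : FiltCx.{u} k} {n : ℤ} {L : CochainComplex (ModuleCat.{u} k) ℤ}
    {f g : K.grCx n ⟶ L}
    (h : ∀ i x hx, (f.f i).hom (K.grMk n i x hx) = (g.f i).hom (K.grMk n i x hx)) : f = g := by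
  apply HomologicalComplex.hom_ext
  intro i
  apply ModuleCat.hom_ext
  apply LinearMap.ext
  intro x
  obtain ⟨x, hx, rfl⟩ := K.grMk_surj n i x
  exact h i x hx

/-- The functor `gr^W_n` from filtered complexes to complexes. -/
def FiltCx.gr (n : ℤ) : FiltCx.{u} k ⥤ CochainComplex.Plus (ModuleCat.{u} k) where
  obj K := ⟨K.grCx n, by
    obtain ⟨m, hm⟩ := K.cx.property
    refine ⟨m, ?_⟩
    rw [CochainComplex.isStrictlyGE_iff] at hm ⊢
    intro i hi
    have : Subsingleton (K.cx.obj.X i) := ModuleCat.subsingleton_of_isZero (hm i hi)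
    have : Subsingleton (Subq (K.W n i) (K.W (n - 1) i)) :=
      (Submodule.mkQ_surjective _).subsingleton
    exact ModuleCat.isZero_of_subsingleton (ModuleCat.of k (Subq (K.W n i) (K.W (n - 1) i)))⟩
  map f := ⟨FiltCx.grCxMap f n⟩
  map_id K := by
    apply ObjectProperty.hom_ext
    exact FiltCx.grCx_hom_ext fun i x hx => rfl
  map_comp f g := by
    apply ObjectProperty.hom_ext
    exact FiltCx.grCx_hom_ext fun i x hx => rfl

variable (k) in
/-- The filtered quasi-isomorphisms: the morphisms of filtered complexes inducing
quasi-isomorphisms on all the graded pieces. -/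
def FiltCx.quasiIso : MorphismProperty (FiltCx.{u} k) :=
  fun _ _ f => ∀ n, CochainComplex.Plus.quasiIso _ ((FiltCx.gr n).map f)

variable (k) in
/-- The bounded below filtered derived category `D⁺F(k)`: bounded below complexes with a
biregular filtration, localized at the filtered quasi-isomorphisms. -/
abbrev DPlusF : Type _ := (FiltCx.quasiIso.{u} k).Localization

/-- The localization functor to `D⁺F(k)`. -/
abbrev DPlusF.Q : FiltCx.{u} k ⥤ DPlusF.{u} k := (FiltCx.quasiIso.{u} k).Q

/-- The functor `gr^W_n : D⁺F(k) ⥤ D⁺(k)`. -/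
def DPlusF.gr (n : ℤ) : DPlusF.{u} k ⥤ DPlus.{u} k :=
  Localization.Construction.lift (FiltCx.gr n ⋙ DPlus.Q)
    (fun _ _ _ hf => MorphismProperty.Q_inverts _ _ (hf n))

section
variable {K L : FiltCx.{u} k} {f : K ⟶ L}

lemma gr_surj (hf : FiltCx.quasiIso k f) (n i j l : ℤ) (hij : i + 1 = j) (hjl : j + 1 = l)
    (y : L.cx.obj.X j) (hy : y ∈ L.W n j) (hdy : (L.cx.obj.d j l).hom y ∈ L.W (n - 1) l) :
    ∃ x ∈ K.W n j, (K.cx.obj.d j l).hom x ∈ K.W (n - 1) l ∧ ∃ v ∈ L.W n i,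
      ∃ w ∈ L.W (n - 1) j,
        y = (f.hom.hom.f j).hom x + (L.cx.obj.d i j).hom v + w := by
  obtain rfl : i = j - 1 := by omega
  subst hjl
  have hs : Function.Surjective (Coh.map (FiltCx.grCxMap f n) j) :=
    ((quasiIso_iff_bijective _).1 (hf n) j).2
  obtain ⟨x, hx⟩ := hs
    (Coh.mk (L.grCx n) j (L.grMk n j y hy) (by
      rw [FiltCx.d_grMk, FiltCx.grMk_eq_zero]; exact hdy))
  obtain ⟨x, hxc, rfl⟩ := Coh.mk_surj _ _ x
  obtain ⟨x, hxW, rfl⟩ := K.grMk_surj n j x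
  obtain ⟨v, hv⟩ := (Coh.mk_eq _ _ _ _ _ _).1 hx.symm
  obtain ⟨v, hvW, rfl⟩ := L.grMk_surj n _ v
  have hw := (L.grMk_eq n j _ (sub_mem hy (f.map_le n j hxW)) _
    (L.biregular.map_d n _ j hvW)).1 hv.symm
  refine ⟨x, hxW, (K.grMk_eq_zero n _ _ _).1 hxc, v, hvW, _, hw, by abel⟩

lemma gr_inj (hf : FiltCx.quasiIso k f) (n i j l : ℤ) (hij : i + 1 = j) (hjl : j + 1 = l)
    (x : K.cx.obj.X j) (hx : x ∈ K.W n j) (hdx : (K.cx.obj.d j l).hom x = 0)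
    (y : L.cx.obj.X i) (hy : y ∈ L.W n i)
    (hxy : (f.hom.hom.f j).hom x = (L.cx.obj.d i j).hom y) :
    ∃ z ∈ K.W n i, ∃ w ∈ K.W (n - 1) j, x = (K.cx.obj.d i j).hom z + w := by
  obtain rfl : i = j - 1 := by omega
  subst hjl
  have h1 : ((K.grCx n).d j (j + 1)).hom (K.grMk n j x hx) = 0 := by
    rw [FiltCx.d_grMk, FiltCx.grMk_eq_zero, hdx]
    exact zero_mem _
  have h0 : Coh.mk (K.grCx n) j (K.grMk n j x hx) h1 = 0 := by
    have hs : Function.Injective (Coh.map (FiltCx.grCxMap f n) j) :=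
      ((quasiIso_iff_bijective _).1 (hf n) j).1
    apply hs
    refine Eq.trans ?_ (map_zero (Coh.map (FiltCx.grCxMap f n) j)).symm
    refine (Coh.mk_eq_zero _ _ _ _).2 ⟨L.grMk n (j - 1) y hy, ?_⟩
    exact (L.grMk_eq n j _ (L.biregular.map_d n (j - 1) j hy) _ (f.map_le n j hx)).2 (by
      rw [hxy, sub_self]; exact zero_mem _)
  obtain ⟨z, hz⟩ := (Coh.mk_eq_zero _ _ _ _).1 h0
  obtain ⟨z, hzW, rfl⟩ := K.grMk_surj n _ z
  have hw := (K.grMk_eq n j x hx _ (K.biregular.map_d n (j - 1) j hzW)).1 hz.symm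
  exact ⟨z, hzW, _, hw, (add_sub_cancel _ _).symm⟩

lemma filt_inj (hf : FiltCx.quasiIso k f) (a n h i j l : ℤ) (hhi : h + 1 = i) (hij : i + 1 = j)
    (hjl : j + 1 = l) (ha : K.W a j = ⊥) (han : a ≤ n)
    (x : K.cx.obj.X j) (hx : x ∈ K.W n j) (hdx : (K.cx.obj.d j l).hom x = 0)
    (y : L.cx.obj.X i) (hy : y ∈ L.W n i)
    (hxy : (f.hom.hom.f j).hom x = (L.cx.obj.d i j).hom y) :
    ∃ z ∈ K.W n i, x = (K.cx.obj.d i j).hom z := by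
  induction n, han using Int.leInduction generalizing x y with
  | base =>
    rw [ha, Submodule.mem_bot] at hx
    exact ⟨0, zero_mem _, by rw [hx, map_zero]⟩
  | succ n hn ih =>
    have e : n + 1 - 1 = n := by omega
    obtain ⟨z, hz, x', hx', rfl⟩ := gr_inj hf (n + 1) i j l hij hjl x hx hdx y hy hxy
    rw [e] at hx'
    have hxy' : (f.hom.hom.f j).hom x' =
        (L.cx.obj.d i j).hom (y - (f.hom.hom.f i).hom z) := by
      rw [map_sub, ← hxy, map_add, hom_comm f.hom.hom i j z]
      abel
    obtain ⟨t, ht, hdt, v, hv, w, hw, hyw⟩ := gr_surj hf (n + 1) h i j hhi hij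
      (y - (f.hom.hom.f i).hom z) (sub_mem hy (f.map_le _ _ hz)) (by
        rw [← hxy', e]
        exact f.map_le _ _ hx')
    rw [e] at hdt hw
    have hdx' : (K.cx.obj.d j l).hom x' = 0 := by
      rwa [map_add, d_d, zero_add] at hdx
    obtain ⟨z', hz', hxz⟩ := ih (x' - (K.cx.obj.d i j).hom t) (sub_mem hx' hdt)
      (by rw [map_sub, d_d, hdx', sub_zero]) w hw (by
        rw [map_sub, hxy', hyw, map_add, map_add, d_d, hom_comm]
        abel)
    refine ⟨z + t + z', add_mem (add_mem hz ?_) (K.biregular.mono _ _ _ (by omega) hz'), ?_⟩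
    · exact ht
    · rw [map_add, map_add, ← hxz]
      abel

lemma filt_surj (hf : FiltCx.quasiIso k f) (a n i j l m : ℤ) (hij : i + 1 = j)
    (hjl : j + 1 = l) (hlm : l + 1 = m) (ha : L.W a j = ⊥) (ha' : K.W a l = ⊥) (han : a ≤ n)
    (y : L.cx.obj.X j) (hy : y ∈ L.W n j) (hdy : (L.cx.obj.d j l).hom y = 0) :
    ∃ x ∈ K.W n j, (K.cx.obj.d j l).hom x = 0 ∧ ∃ v ∈ L.W n i,
      y = (f.hom.hom.f j).hom x + (L.cx.obj.d i j).hom v := by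
  induction n, han using Int.leInduction generalizing y with
  | base =>
    rw [ha, Submodule.mem_bot] at hy
    exact ⟨0, zero_mem _, map_zero _, 0, zero_mem _, by simp [hy]⟩
  | succ n hn ih =>
    have e : n + 1 - 1 = n := by omega
    obtain ⟨x, hx, hdx, v, hv, w, hw, rfl⟩ := gr_surj hf (n + 1) i j l hij hjl y hy
      (by rw [hdy]; exact zero_mem _)
    rw [e] at hdx hw
    have hdy' : (L.cx.obj.d j l).hom w = - (f.hom.hom.f l).hom ((K.cx.obj.d j l).hom x) := by
      rw [map_add, map_add, d_d, add_zero, hom_comm] at hdy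
      exact eq_neg_of_add_eq_zero_right hdy
    obtain ⟨z, hz, hxz⟩ := filt_inj hf a n i j l m hij hjl hlm ha' hn _ hdx (d_d _ _ _ _ _)
      (-w) (neg_mem hw) (by rw [map_neg, hdy', neg_neg])
    obtain ⟨x', hx', hdx', v', hv', he⟩ := ih (w + (f.hom.hom.f j).hom z)
      (add_mem hw (f.map_le _ _ hz)) (by
        rw [map_add, hdy', hom_comm, hxz]
        abel)
    refine ⟨x - z + x', add_mem (sub_mem hx (K.biregular.mono _ _ _ (by omega) hz))
      (K.biregular.mono _ _ _ (by omega) hx'), ?_, v + v',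
      add_mem hv (L.biregular.mono _ _ _ (by omega) hv'), ?_⟩
    · rw [map_add, map_sub, hdx', hxz]
      abel
    · rw [eq_sub_of_add_eq he]
      simp only [map_add, map_sub]
      abel

/-- A filtered quasi-isomorphism is a quasi-isomorphism (the filtrations are biregular). -/
lemma quasiIso_of_filtered (hf : FiltCx.quasiIso k f) :
    CochainComplex.Plus.quasiIso _ (FiltCx.forget.map f) := by
  rw [quasiIso_iff_bijective]
  intro i
  change Function.Bijective (Coh.map (FiltCx.Hom.hom f).hom i)
  constructor
  · rw [← LinearMap.ker_eq_bot, LinearMap.ker_eq_bot']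
    intro x hx
    obtain ⟨x, hxc, rfl⟩ := Coh.mk_surj _ _ x
    obtain ⟨y, hy⟩ := (Coh.mk_eq_zero _ _ _ _).1 hx
    obtain ⟨a, b, ha, hb⟩ := K.biregular.finite i
    obtain ⟨-, b', -, hb'⟩ := L.biregular.finite (i - 1)
    obtain ⟨z, -, hz⟩ := filt_inj hf a (max a (max b b')) (i - 1 - 1) (i - 1) i (i + 1)
      (by omega) (by omega) (by omega) ha (by omega) x
      (K.biregular.mono _ b _ (by omega) (by rw [hb]; trivial)) hxc y
      (L.biregular.mono _ b' _ (by omega) (by rw [hb']; trivial)) hy.symm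
    exact (Coh.mk_eq_zero _ _ _ _).2 ⟨z, hz.symm⟩
  · intro y
    obtain ⟨y, hyc, rfl⟩ := Coh.mk_surj _ _ y
    obtain ⟨a, b, ha, hb⟩ := L.biregular.finite i
    obtain ⟨a', -, ha', -⟩ := K.biregular.finite (i + 1)
    obtain ⟨x, -, hx, v, -, hv⟩ := filt_surj hf (min a a') (max a b) (i - 1) i (i + 1) (i + 1 + 1)
      (by omega) (by omega) (by omega)
      (le_bot_iff.1 (ha ▸ L.biregular.mono i _ _ (by omega)))
      (le_bot_iff.1 (ha' ▸ K.biregular.mono _ _ _ (by omega))) (by omega) y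
      (L.biregular.mono _ b _ (by omega) (by rw [hb]; trivial)) hyc
    refine ⟨Coh.mk K.cx.obj i x hx, ?_⟩
    refine (Coh.mk_eq L.cx.obj i _ (by
      change (L.cx.obj.d i (i + 1)).hom ((f.hom.hom.f i).hom x) = 0
      rw [hom_comm, hx, map_zero]) _ _).2 ⟨-v, ?_⟩
    change (L.cx.obj.d (i - 1) i).hom (-v) = (f.hom.hom.f i).hom x - y
    rw [hv, map_neg]
    abel

end

/-- The functor `D⁺F(k) ⥤ D⁺(k)` forgetting the filtration. -/
def DPlusF.forget : DPlusF.{u} k ⥤ DPlus.{u} k :=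
  Localization.Construction.lift (FiltCx.forget ⋙ DPlus.Q)
    (fun _ _ _ hf => MorphismProperty.Q_inverts _ _ (quasiIso_of_filtered hf))

end Complexes

/-! ## Complexification -/

section Complexification

/-- The complex `ℂ ⊗ K` of a complex `K` of `ℚ`-vector spaces. -/
def complexify (K : CochainComplex (ModuleCat.{u} ℚ) ℤ) : CochainComplex (ModuleCat.{u} ℂ) ℤ where
  X i := ModuleCat.of ℂ (ℂ ⊗[ℚ] K.X i)
  d i j := ModuleCat.ofHom ((K.d i j).hom.baseChange ℂ)
  shape i j h := by
    rw [K.shape i j h, ModuleCat.hom_zero, LinearMap.baseChange_zero]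
    rfl
  d_comp_d' i j l _ _ := by
    rw [← ModuleCat.ofHom_comp, ← LinearMap.baseChange_comp, ← ModuleCat.hom_comp,
      K.d_comp_d, ModuleCat.hom_zero, LinearMap.baseChange_zero]
    rfl

/-- `ℂ ⊗ K` as a bounded below complex. -/
def complexifyPlus (K : CochainComplex.Plus (ModuleCat.{u} ℚ)) :
    CochainComplex.Plus (ModuleCat.{u} ℂ) :=
  ⟨complexify K.obj, by
    obtain ⟨m, hm⟩ := K.property
    refine ⟨m, ?_⟩
    rw [CochainComplex.isStrictlyGE_iff] at hm ⊢
    intro i hi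
    have : Subsingleton (K.obj.X i) := ModuleCat.subsingleton_of_isZero (hm i hi)
    have : Subsingleton (ℂ ⊗[ℚ] K.obj.X i) := inferInstance
    exact ModuleCat.isZero_of_subsingleton (ModuleCat.of ℂ (ℂ ⊗[ℚ] K.obj.X i))⟩

/-- The filtered complex `ℂ ⊗ (K, W)`. -/
def FiltCx.complexify (K : FiltCx.{u} ℚ) : FiltCx.{u} ℂ where
  cx := complexifyPlus K.cx
  W n i := (K.W n i).baseChange ℂ
  biregular :=
    { mono := fun i m n h => Submodule.baseChange_mono _ (K.biregular.mono i m n h)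
      map_d := fun n i j => by
        have h : (K.W n i).baseChange ℂ ≤
            ((K.W n j).baseChange ℂ).comap ((K.cx.obj.d i j).hom.baseChange ℂ) := by
          rw [Submodule.baseChange_eq_span, Submodule.span_le]
          rintro _ ⟨x, hx, rfl⟩
          exact Submodule.tmul_mem_baseChange_of_mem (A := ℂ) 1 (K.biregular.map_d n i j hx)
        exact h
      finite := fun i => by
        obtain ⟨a, b, ha, hb⟩ := K.biregular.finite i
        exact ⟨a, b, by rw [ha]; exact Submodule.baseChange_bot _,
          by rw [hb]; exact Submodule.baseChange_top _⟩ }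

/-- The natural isomorphism `ℂ ⊗ gr^W_n K ≅ gr^W_n (ℂ ⊗ K)`, in each degree. -/
def grComplexEquiv (K : FiltCx.{u} ℚ) (n i : ℤ) :
    ℂ ⊗[ℚ] Subq (K.W n i) (K.W (n - 1) i) ≃ₗ[ℂ]
      Subq (K.complexify.W n i) (K.complexify.W (n - 1) i) :=
  LinearEquiv.ofBijective (Subq.complexMap _ _ _ _ le_rfl le_rfl)
    (Subq.complexMap_bijective _ _ _ _ rfl rfl (K.biregular.mono i _ _ (by omega)))

lemma grComplexEquiv_tmul (K : FiltCx.{u} ℚ) (n i : ℤ) (c : ℂ) (x : K.W n i) :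
    grComplexEquiv K n i (c ⊗ₜ Submodule.Quotient.mk x) =
      c • (Submodule.Quotient.mk ⟨(1 : ℂ) ⊗ₜ[ℚ] (x : K.cx.obj.X i),
        Submodule.tmul_mem_baseChange_of_mem (A := ℂ) 1 x.2⟩ :
          Subq (K.complexify.W n i) (K.complexify.W (n - 1) i)) :=
  Subq.complexMap_tmul _ _ _ _ le_rfl le_rfl c x

lemma grComplexEquiv_d (K : FiltCx.{u} ℚ) (n i j : ℤ)
    (t : ℂ ⊗[ℚ] Subq (K.W n i) (K.W (n - 1) i)) :
    Subq.map (A := K.complexify.W n i) (B := K.complexify.W (n - 1) i)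
      (A' := K.complexify.W n j) (B' := K.complexify.W (n - 1) j)
      (K.complexify.cx.obj.d i j).hom (K.complexify.biregular.map_d n i j)
      (K.complexify.biregular.map_d (n - 1) i j) (grComplexEquiv K n i t) =
    grComplexEquiv K n j ((Subq.map (A := K.W n i) (B := K.W (n - 1) i)
      (A' := K.W n j) (B' := K.W (n - 1) j) (K.cx.obj.d i j).hom (K.biregular.map_d n i j)
      (K.biregular.map_d (n - 1) i j)).baseChange ℂ t) := by
  induction t with
  | zero => simp only [map_zero]
  | add x y hx hy => simp only [map_add, hx, hy]
  | tmul c x =>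
    obtain ⟨x, rfl⟩ := Submodule.Quotient.mk_surjective _ x
    rw [grComplexEquiv_tmul, map_smul, Subq.map_mk, LinearMap.baseChange_tmul, Subq.map_mk,
      grComplexEquiv_tmul]
    rfl

/-- The natural isomorphism of complexes `ℂ ⊗ gr^W_n K ≅ gr^W_n (ℂ ⊗ K)`. -/
def grComplexIso (K : FiltCx.{u} ℚ) (n : ℤ) :
    complexifyPlus ((FiltCx.gr n).obj K) ≅ (FiltCx.gr n).obj K.complexify :=
  ObjectProperty.isoMk _ (HomologicalComplex.Hom.isoOfComponents
    (fun i => (grComplexEquiv K n i).toModuleIso)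
    (fun i j _ => by
      apply ModuleCat.hom_ext
      apply LinearMap.ext
      intro t
      exact grComplexEquiv_d K n i j t))

/-- The natural isomorphism `ℂ ⊗ H^i(K) ≃ H^i(ℂ ⊗ K)`, `c ⊗ [x] ↦ c • [1 ⊗ x]`. -/
def cohComplexEquiv (K : CochainComplex (ModuleCat.{u} ℚ) ℤ) (i : ℤ) :
    ℂ ⊗[ℚ] Coh K i ≃ₗ[ℂ] Coh (complexify K) i :=
  LinearEquiv.ofBijective
    (Subq.complexMap (cocycles K i) (coboundaries K i)
      (cocycles (complexify K) i) (coboundaries (complexify K) i)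
      (ker_baseChange_complex _).le (range_baseChange_complex _).le)
    (Subq.complexMap_bijective _ _ _ _ (ker_baseChange_complex _) (range_baseChange_complex _)
      (by rintro _ ⟨y, rfl⟩; exact d_d K _ _ _ y))

/-- The isomorphism `ℂ ⊗ H^i(K) ≃ H^i(ℂ ⊗ K) ≃ H^i(L)` given by an isomorphism `ℂ ⊗ K ≅ L` in
`D⁺(ℂ)`. -/
def comparison {K : CochainComplex.Plus (ModuleCat.{u} ℚ)}
    {L : CochainComplex.Plus (ModuleCat.{u} ℂ)}
    (α : DPlus.Q.obj (complexifyPlus K) ≅ DPlus.Q.obj L) (i : ℤ) :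
    ℂ ⊗[ℚ] Coh K.obj i ≃ₗ[ℂ] Coh L.obj i :=
  (cohComplexEquiv K.obj i).trans (DPlus.cohEquiv α i)

/-- The filtration on `ℂ ⊗ H^i(K)` corresponding, under the isomorphism `ℂ ⊗ H^i(K) ≃ H^i(L)`
given by `α`, to the filtration on `H^i(L)` induced by the filtration `F` of the complex `L`. -/
def hodgeFiltration {K : CochainComplex.Plus (ModuleCat.{u} ℚ)}
    {L : CochainComplex.Plus (ModuleCat.{u} ℂ)}
    (α : DPlus.Q.obj (complexifyPlus K) ≅ DPlus.Q.obj L)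
    (F : ℤ → ∀ i : ℤ, Submodule ℂ (L.obj.X i)) (i p : ℤ) : Submodule ℂ (ℂ ⊗[ℚ] Coh K.obj i) :=
  (Coh.induced L.obj i (F p i)).comap (comparison α i).toLinearMap

end Complexification

/-! ## Infinite Hodge complexes and infinite mixed Hodge complexes -/

/-- The data of a bounded below complex `K` of `ℚ`-vector spaces, a bounded below complex
`(L, F)` of `ℂ`-vector spaces with a decreasing filtration, and an isomorphism
`α : ℂ ⊗ K ≅ L` in `D⁺(ℂ)`, form an infinite Hodge complex of weight `n`: the filtration `F` is
biregular, the differential of `L` is strictly compatible with `F` (equivalently, the spectral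
sequence of `(L, F)` degenerates at `E₁`), and `F` induces a Hodge structure of weight `n + i` on
`H^i(K)`, for all `i`. -/
structure IsInfiniteHodgeComplex (n : ℤ) (K : CochainComplex.Plus (ModuleCat.{u} ℚ))
    (L : CochainComplex.Plus (ModuleCat.{u} ℂ)) (F : ℤ → ∀ i : ℤ, Submodule ℂ (L.obj.X i))
    (α : DPlus.Q.obj (complexifyPlus K) ≅ DPlus.Q.obj L) : Prop where
  biregular : IsDecreasingBiregular L.obj F
  strict : ∀ p i : ℤ, LinearMap.range (L.obj.d i (i + 1)).hom ⊓ F p (i + 1) ≤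
    (F p i).map (L.obj.d i (i + 1)).hom
  hodge : ∀ i : ℤ, IsInfiniteHodgeStructure (n + i) (hodgeFiltration α F i)

/-- The filtration induced by `F` on the complex `gr^W_n K`. -/
def FiltCx.grFiltration {k : Type} [Field k] (K : FiltCx.{u} k)
    (F : ℤ → ∀ i : ℤ, Submodule k (K.cx.obj.X i)) (n p i : ℤ) :
    Submodule k (((FiltCx.gr n).obj K).obj.X i) :=
  Subq.induced (K.W n i) (K.W (n - 1) i) (F p i)

/-- An infinite mixed Hodge complex: a filtered complex `(K, W)` of `ℚ`-vector spaces, a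
bifiltered complex `(K_ℂ, W, F)` of `ℂ`-vector spaces, and an isomorphism `α : ℂ ⊗ K ≅ K_ℂ` in
`D⁺F(ℂ)` (for the filtrations `W`), such that, for all `n`, the complexes `gr^W_n K` and
`(gr^W_n K_ℂ, F)`, with the isomorphism `gr^W_n α`, form an infinite Hodge complex of weight
`n`. -/
structure InfiniteMixedHodgeComplex where
  K : FiltCx.{u} ℚ
  KC : FiltCx.{u} ℂ
  F : ℤ → ∀ i : ℤ, Submodule ℂ (KC.cx.obj.X i)
  F_biregular : IsDecreasingBiregular KC.cx.obj F
  α : DPlusF.Q.obj K.complexify ≅ DPlusF.Q.obj KC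
  gr : ∀ n : ℤ, IsInfiniteHodgeComplex n ((FiltCx.gr n).obj K) ((FiltCx.gr n).obj KC)
    (KC.grFiltration F n) (DPlus.Q.mapIso (grComplexIso K n) ≪≫ (DPlusF.gr n).mapIso α)

namespace InfiniteMixedHodgeComplex

variable (M : InfiniteMixedHodgeComplex.{u})

/-- The cohomology `H^i(K)`, a `ℚ`-vector space. -/
abbrev H (i : ℤ) : Type u := Coh M.K.cx.obj i

/-- The isomorphism `ℂ ⊗ K ≅ K_ℂ` in `D⁺(ℂ)` obtained from `α` by forgetting `W`. -/
def αForget : DPlus.Q.obj (complexifyPlus M.K.cx) ≅ DPlus.Q.obj M.KC.cx :=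
  DPlusF.forget.mapIso M.α

/-- The filtration induced by `F` on `ℂ ⊗ H^i(K) ≃ H^i(K_ℂ)`. -/
def hodge (i p : ℤ) : Submodule ℂ (ℂ ⊗[ℚ] M.H i) := hodgeFiltration M.αForget M.F i p

end InfiniteMixedHodgeComplex

/-! ## The shifted filtration and the weight spectral sequence -/

section Weight

variable {k : Type} [Field k] (K : FiltCx.{u} k)

/-- The shifted filtration `Dec(W)_n K^i = W_{n-i} K^i`. -/
def FiltCx.dec (n i : ℤ) : Submodule k (K.cx.obj.X i) := K.W (n - i) i

/-- The filtration induced by `Dec(W)` on `H^i(K)`. -/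
def FiltCx.decCoh (i n : ℤ) : Submodule k (Coh K.cx.obj i) := Coh.induced K.cx.obj i (K.dec n i)

/-- The variant of `Dec(W)` by subcomplexes, `{x ∈ W_{n-i} K^i | d x ∈ W_{n-i-1} K^{i+1}}`. -/
def FiltCx.decSub (n i : ℤ) : Submodule k (K.cx.obj.X i) :=
  K.W (n - i) i ⊓ (K.W (n - i - 1) (i + 1)).comap (K.cx.obj.d i (i + 1)).hom

/-- Both variants of `Dec(W)` induce the same filtration in cohomology. -/
lemma FiltCx.induced_decSub (i n : ℤ) :
    Coh.induced K.cx.obj i (K.decSub n i) = K.decCoh i n := by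
  have : (K.decSub n i).comap (cocycles K.cx.obj i).subtype =
      (K.dec n i).comap (cocycles K.cx.obj i).subtype := by
    ext x
    constructor
    · exact fun h => h.1
    · refine fun h => ⟨h, ?_⟩
      change (K.cx.obj.d i (i + 1)).hom x ∈ K.W (n - i - 1) (i + 1)
      rw [LinearMap.mem_ker.1 x.2]
      exact zero_mem _
  unfold Coh.induced decCoh Coh.induced Subq.induced
  rw [this]

/-- `Z_r^{p,i-p} = {x ∈ W_{-p} K^i | d x ∈ W_{-p-r} K^{i+1}}`, for the spectral sequence of the
decreasing filtration `p ↦ W_{-p}`; the last index is the total degree. -/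
def FiltCx.Z (r p i : ℤ) : Submodule k (K.cx.obj.X i) :=
  K.W (-p) i ⊓ (K.W (-(p + r)) (i + 1)).comap (K.cx.obj.d i (i + 1)).hom

/-- `Z_{r-1}^{p+1,i-p-1} + d Z_{r-1}^{p-r+1,i-p+r-2}`, a subspace of `Z_r^{p,i-p}`. -/
def FiltCx.B (r p i : ℤ) : Submodule k (K.cx.obj.X i) :=
  K.Z (r - 1) (p + 1) i ⊔ (K.Z (r - 1) (p - r + 1) (i - 1)).map (K.cx.obj.d (i - 1) i).hom

/-- The term `E_r^{p,i-p}` of the weight spectral sequence of `(K, W)`. -/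
abbrev FiltCx.E (r p i : ℤ) : Type u := Subq (K.Z r p i) (K.B r p i)

/-- The differential `d_r : E_r^{p,q} → E_r^{p+r,q-r+1}` of the weight spectral sequence, with
`q = i - p`; it is induced by the differential of `K`. -/
def FiltCx.dE (r p i : ℤ) : K.E r p i →ₗ[k] K.E r (p + r) (i + 1) :=
  Subq.map (K.cx.obj.d i (i + 1)).hom
    (fun x hx => ⟨hx.2, by
      rw [SetLike.mem_coe, Submodule.mem_comap, d_d]
      exact zero_mem _⟩)
    (sup_le
      (fun x hx => Submodule.mem_sup_right (by
        have key : ∀ j p' : ℤ, j = i → p' = p + 1 → (K.cx.obj.d i (i + 1)).hom x ∈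
            (K.Z (r - 1) p' j).map (K.cx.obj.d j (i + 1)).hom := by
          rintro _ _ rfl rfl
          exact ⟨x, hx, rfl⟩
        exact key _ _ (by omega) (by omega)))
      (by
        rintro _ ⟨x, -, rfl⟩
        rw [Submodule.mem_comap, d_d]
        exact zero_mem _))

/-- The weight spectral sequence of `(K, W)` degenerates at `E_s`. -/
def FiltCx.DegeneratesAt (s : ℤ) : Prop := ∀ r p i : ℤ, s ≤ r → K.dE r p i = 0

end Weight

end InfHodge

end

/-! The underlying argument is Deligne's. Each $d_1$ is a morphism of Hodge structures, since it
joins $H^i(\mathrm{gr}^W_n)$ to $H^{i+1}(\mathrm{gr}^W_{n-1})$, both of weight $n+i$. Hence it is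
strict for $F$, and $E_2$ again carries opposed filtrations. For $r\ge 2$ the target of $d_r$ has
weight smaller by $r-1$, so $d_r$ of a class of type $(a,b)$ lies in $F^a\cap\bar F^b$ with $a+b$
above the weight, and vanishes.

Two points need care. First, $K_{\mathbb C}$ has no conjugation on cochains: it exists only on
$H(\mathrm{gr}^W_nK_{\mathbb C})$ and $H(K_{\mathbb C})$, through $\alpha$. The differentials and
the passage from $H$ to $\mathrm{gr}^W H$ are therefore encoded as additive relations, `FiltCx.DRel`
and `FiltCx.RRel`, between groups that do not depend on a page. These relations are preserved and
reflected by filtered quasi-isomorphisms, hence carried along by morphisms of $D^+F$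
(`DPlusF.dRel_map`, `DPlusF.rRel_map`). As conjugation acts termwise on $\mathbb C\otimes K$, it
respects them on $K_{\mathbb C}$ as well.

Second, $d_r$ must be shown to respect $F$ although $F$ induces several filtrations on $E_r$ a
priori. Strictness of $d_0$ and $d_1$ (`FiltCx.IsPure.strict_two`), with the vanishing of $d_s$ for
$2\le s<r$, allows a class of $F^p$ in $\ker d_1$ to be represented by some $x\in F^p$ with $dx\in
W_{n-r}$ (`FiltCx.IsPure.exists_rep`). The vanishing of $d_r$ follows in `FiltCx.IsPure.deg_step`.

After degeneration, $\mathrm{gr}^W_nH^i$ is $\ker d_1/\operatorname{im}d_1$, with the same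
filtration $F$ on both sides, so opposedness passes to it (`FiltCx.IsPure.coh_split`,
`FiltCx.IsPure.coh_disjoint`). Its weight is $n+i$, which is the shift made by $\mathrm{Dec}$.
Degeneration goes from $K_{\mathbb C}$ to $\mathbb C\otimes K$ by $\alpha$, and to $K$ by faithful
flatness of $\mathbb C$ over $\mathbb Q$ (`exists_d_eq_of_complexify`). -/

noncomputable section

namespace InfHodge

/-! ### Inclusions of induced subspaces in a subquotient. -/

section Subquotients

variable {k : Type*} [Field k] {M : Type*} [AddCommGroup M] [Module k M]

lemma Subq.induced_le_induced_iff {A B F F' : Submodule k M} :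
    Subq.induced A B F ≤ Subq.induced A B F' ↔ A ⊓ F ≤ A ⊓ F' ⊔ B := by
  constructor
  · rintro h x ⟨hxA, hxF⟩
    obtain ⟨y, hy, hyx⟩ := h ⟨⟨x, hxA⟩, hxF, rfl⟩
    have h1 : (⟨x, hxA⟩ - y : A) ∈ B.comap A.subtype :=
      (Submodule.Quotient.eq (B.comap A.subtype)).1 hyx.symm
    exact Submodule.mem_sup.2 ⟨y, ⟨y.2, hy⟩, x - y, h1, by abel⟩
  · rintro h _ ⟨x, hx, rfl⟩
    obtain ⟨y, ⟨hyA, hyF⟩, z, hz, hyz⟩ := Submodule.mem_sup.1 (h ⟨x.2, hx⟩)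
    refine ⟨⟨y, hyA⟩, hyF, (Submodule.Quotient.eq (B.comap A.subtype)).2 ?_⟩
    change y - (x : M) ∈ B
    rw [← hyz, sub_add_cancel_left]
    exact neg_mem hz

lemma Subq.subsingleton_iff {A B : Submodule k M} : Subsingleton (Subq A B) ↔ A ≤ B := by
  rw [Submodule.Quotient.subsingleton_iff, Submodule.comap_subtype_eq_top]

end Subquotients

/-! ### Opposed filtrations as complementary subspaces, without finite dimension. -/

section Opposed

variable {E : Type*} [AddCommGroup E] [Module ℂ E] {n : ℤ} {F G : ℤ → Submodule ℂ E}

lemma isOpposed_iff : IsOpposed n F G ↔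
    ∀ p q : ℤ, p + q ≠ n → G q ⊓ F p ≤ G q ⊓ F (p + 1) ⊔ G (q + 1) := by
  simp only [IsOpposed, Subq.subsingleton_iff, Subq.induced_le_induced_iff]

/-- Opposedness pushes an element of $F^p\cap G^q$ to $F^{p+1}$ or $G^{q+1}$. The induction is on
the distance from $p+q$ to $b+b'$, beyond which one of the two steps is zero. -/
lemma IsOpposed.disjoint (h : IsOpposed n F G) (hF : Antitone F) (hG : Antitone G)
    {b b' : ℤ} (hb : F b = ⊥) (hb' : G b' = ⊥) (p q : ℤ) (hpq : n < p + q) :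
    Disjoint (F p) (G q) := by
  rw [isOpposed_iff] at h
  have key : ∀ N : ℕ, ∀ p q : ℤ, n < p + q → b + b' ≤ p + q + N → F p ⊓ G q = ⊥ := by
    intro N
    induction N with
    | zero =>
      intro p q _ hN
      rcases le_or_gt b p with hp | hp
      · rw [eq_bot_iff.2 ((hF hp).trans hb.le), bot_inf_eq]
      · rw [eq_bot_iff.2 ((hG (show b' ≤ q by push_cast at hN; omega)).trans hb'.le), inf_bot_eq]
    | succ N ih =>
      intro p q hpq hN
      push_cast at hN
      rw [eq_bot_iff]
      rintro x ⟨hxF, hxG⟩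
      obtain ⟨y, ⟨hyG, hyF⟩, z, hz, rfl⟩ := Submodule.mem_sup.1 (h p q (by omega) ⟨hxG, hxF⟩)
      have hy : y ∈ F (p + 1) ⊓ G q := ⟨hyF, hyG⟩
      rw [ih (p + 1) q (by omega) (by omega), Submodule.mem_bot] at hy
      subst hy
      have hz' : z ∈ F p ⊓ G (q + 1) := ⟨by simpa using hxF, hz⟩
      rw [ih p (q + 1) (by omega) (by omega), Submodule.mem_bot] at hz'
      simp [hz']
  exact disjoint_iff.2 (key (b + b' - (p + q)).toNat p q hpq (by omega))

/-- Below the diagonal, opposedness lets $q$ grow up to $n-p$ and gives $F^p\subseteq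
F^{p+1}+G^{n-p}$. This carries $F^p+G^{n+1-p}=E$ from $p$ to $p+1$, starting where $F^p=E$. -/
lemma IsOpposed.codisjoint (h : IsOpposed n F G) (hF : Antitone F) (hG : Antitone G)
    {a a' : ℤ} (ha : F a = ⊤) (ha' : G a' = ⊤) (p : ℤ) : Codisjoint (F p) (G (n + 1 - p)) := by
  rw [isOpposed_iff] at h
  -- The minimum keeps $q=n-p$ within reach of the induction even when $n-p<a'$; at the base $G^q$
  -- is the whole space in either case.
  have key : ∀ p q : ℤ, min a' (n - p) ≤ q → p + q ≤ n → F p ≤ F (p + 1) ⊔ F p ⊓ G q := by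
    intro p q hq
    induction q, hq using Int.leInduction with
    | base =>
      intro _
      rw [eq_top_iff.2 (ha'.ge.trans (hG (min_le_left a' (n - p)))), inf_top_eq]
      exact le_sup_right
    | succ q hq ih =>
      intro hpq x hx
      obtain ⟨y, hy, z, ⟨hzF, hzG⟩, rfl⟩ := Submodule.mem_sup.1 (ih (by omega) hx)
      obtain ⟨s, ⟨hsG, hsF⟩, t, ht, rfl⟩ := Submodule.mem_sup.1 (h p q (by omega) ⟨hzG, hzF⟩)
      refine Submodule.mem_sup.2 ⟨y + s, add_mem hy hsF, t, ⟨?_, ht⟩, by abel⟩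
      have := sub_mem hzF (hF (show p ≤ p + 1 by omega) hsF)
      rwa [add_sub_cancel_left] at this
  rw [codisjoint_iff]
  rcases le_total p a with hp | hp
  · rw [eq_top_iff.2 (ha.ge.trans (hF hp)), top_sup_eq]
  · induction p, hp using Int.leInduction with
    | base => rw [ha, top_sup_eq]
    | succ p hp ih =>
      rw [eq_top_iff, ← ih]
      refine sup_le ((key p (n - p) (min_le_right _ _) (by omega)).trans ?_)
        ((hG (by omega)).trans le_sup_right)
      exact sup_le_sup_left (inf_le_right.trans (hG (by omega))) _

/-- For $p+q<n$, decompose along $F^{p+1}\oplus G^{n-p}$ and use $G^{n-p}\subseteq G^{q+1}$. For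
$p+q>n$, the intersection $F^p\cap G^q$ is already zero. -/
lemma isOpposed_of_isCompl (hG : Antitone G)
    (h : ∀ p, IsCompl (F p) (G (n + 1 - p))) : IsOpposed n F G := by
  rw [isOpposed_iff]
  rintro p q hpq x ⟨hxG, hxF⟩
  rcases lt_or_gt_of_ne hpq with hlt | hlt
  · obtain ⟨y, hy, z, hz, rfl⟩ := Submodule.mem_sup.1
      ((h (p + 1)).codisjoint.eq_top ▸ Submodule.mem_top (x := x))
    have hz' := hG (show q + 1 ≤ n + 1 - (p + 1) by omega) hz
    refine Submodule.mem_sup.2 ⟨y, ⟨?_, hy⟩, z, hz', rfl⟩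
    have := sub_mem hxG (hG (show q ≤ q + 1 by omega) hz')
    rwa [add_sub_cancel_right] at this
  · have := (h p).disjoint.le_bot ⟨hxF, hG (show n + 1 - p ≤ q by omega) hxG⟩
    rw [(Submodule.mem_bot ℂ).1 this]
    exact zero_mem _

end Opposed

/-! ### Conjugation on $\mathbb C\otimes V$ and Hodge structures as complementary filtrations. -/

section Conjugation

variable {V : Type*} [AddCommGroup V] [Module ℚ V]

@[simp] lemma conjugation_conjugation (x : ℂ ⊗[ℚ] V) : conjugation V (conjugation V x) = x := by
  induction x with
  | zero => simp
  | add x y hx hy => rw [map_add, map_add, hx, hy]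
  | tmul c v => simp

lemma conjugation_baseChange {V' : Type*} [AddCommGroup V'] [Module ℚ V'] (f : V →ₗ[ℚ] V')
    (x : ℂ ⊗[ℚ] V) : conjugation V' (f.baseChange ℂ x) = f.baseChange ℂ (conjugation V x) := by
  induction x with
  | zero => simp
  | add x y hx hy => simp only [map_add, hx, hy]
  | tmul c v => simp

lemma conjugation_mem_baseChange {W : Submodule ℚ V} {x : ℂ ⊗[ℚ] V} (hx : x ∈ W.baseChange ℂ) :
    conjugation V x ∈ W.baseChange ℂ := by
  obtain ⟨y, hy⟩ := W.toBaseChange_surjective ℂ ⟨x, hx⟩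
  have hy' : (W.subtype.baseChange ℂ) y = x := congrArg Subtype.val hy
  rw [← hy', conjugation_baseChange]
  exact (W.toBaseChange ℂ _).2

variable {n : ℤ} {F : ℤ → Submodule ℂ (ℂ ⊗[ℚ] V)}

lemma conjFiltration_antitone (hF : Antitone F) : Antitone (conjFiltration F) :=
  fun _ _ h => Submodule.comap_mono (hF h)

lemma IsInfiniteHodgeStructure.isCompl (h : IsInfiniteHodgeStructure n F) (p : ℤ) :
    IsCompl (F p) (conjFiltration F (n + 1 - p)) := by
  obtain ⟨a, b, ha, hb⟩ := h.finite
  have ha' : conjFiltration F a = ⊤ := by rw [conjFiltration, ha, Submodule.comap_top]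
  have hb' : conjFiltration F b = ⊥ := by
    rw [eq_bot_iff]
    intro x hx
    rw [conjFiltration, hb, Submodule.mem_comap, Submodule.mem_bot] at hx
    rw [Submodule.mem_bot, ← conjugation_conjugation x, hx, map_zero]
  exact ⟨h.opposed.disjoint h.antitone (conjFiltration_antitone h.antitone) hb hb' _ _ (by omega),
    h.opposed.codisjoint h.antitone (conjFiltration_antitone h.antitone) ha ha' _⟩

lemma isInfiniteHodgeStructure_of_isCompl (hF : Antitone F)
    (hfin : ∃ a b : ℤ, F a = ⊤ ∧ F b = ⊥)
    (h : ∀ p, IsCompl (F p) (conjFiltration F (n + 1 - p))) : IsInfiniteHodgeStructure n F :=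
  ⟨hF, hfin, isOpposed_of_isCompl (conjFiltration_antitone hF) h⟩

end Conjugation

/-! ### Differentials of the spectral sequence as additive relations. -/

section Relations

variable {k : Type} [Field k] (A : FiltCx.{u} k)

/-- The class in `H^i(gr^W_n A)` of an element `x` of `W_n A^i` with `d x ∈ W_{n-1} A^{i+1}`. -/
def FiltCx.grCls (n i : ℤ) (x : A.cx.obj.X i) (hx : x ∈ A.W n i)
    (hdx : (A.cx.obj.d i (i + 1)).hom x ∈ A.W (n - 1) (i + 1)) : Coh (A.grCx n) i :=
  Coh.mk (A.grCx n) i (A.grMk n i x hx) (by rw [FiltCx.d_grMk, FiltCx.grMk_eq_zero]; exact hdx)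

/-- The element `x` of `A^i` represents the class `e` in `H^i(gr^W_n A)`. -/
def FiltCx.IsCls (n i : ℤ) (x : A.cx.obj.X i) (e : Coh (A.grCx n) i) : Prop :=
  ∃ hx hdx, e = A.grCls n i x hx hdx

/-- The additive relation underlying the differential `d_{n-m}` of the spectral sequence of
`(A, W)`: the pairs of classes in `H^i(gr^W_n A)` and `H^j(gr^W_m A)` represented by some `x` and
`d x`. -/
def FiltCx.DRel (n m i j : ℤ) (e : Coh (A.grCx n) i) (u : Coh (A.grCx m) j) : Prop :=
  ∃ x, A.IsCls n i x e ∧ A.IsCls m j ((A.cx.obj.d i j).hom x) u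

/-- The additive relation between `H^i(A)` and `H^i(gr^W_n A)` of the pairs of classes of a
cocycle in `W_n A^i`. -/
def FiltCx.RRel (n i : ℤ) (h : Coh A.cx.obj i) (e : Coh (A.grCx n) i) : Prop :=
  ∃ x hx, h = Coh.mk A.cx.obj i x hx ∧ A.IsCls n i x e

variable {A}

lemma FiltCx.exists_isCls {n i j : ℤ} (hij : i + 1 = j) {x : A.cx.obj.X i} (hx : x ∈ A.W n i)
    (hdx : (A.cx.obj.d i j).hom x ∈ A.W (n - 1) j) : ∃ e, A.IsCls n i x e := by
  subst hij
  exact ⟨_, hx, hdx, rfl⟩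

lemma FiltCx.IsCls.mem {n i : ℤ} {x : A.cx.obj.X i} {e : Coh (A.grCx n) i}
    (h : A.IsCls n i x e) : x ∈ A.W n i := h.1

lemma FiltCx.IsCls.d_mem {n i j : ℤ} (hij : i + 1 = j) {x : A.cx.obj.X i} {e : Coh (A.grCx n) i}
    (h : A.IsCls n i x e) : (A.cx.obj.d i j).hom x ∈ A.W (n - 1) j := by
  subst hij
  exact h.2.1

lemma FiltCx.IsCls.add {n i : ℤ} {x y : A.cx.obj.X i} {e f : Coh (A.grCx n) i}
    (h : A.IsCls n i x e) (h' : A.IsCls n i y f) : A.IsCls n i (x + y) (e + f) := by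
  obtain ⟨hx, hdx, rfl⟩ := h
  obtain ⟨hy, hdy, rfl⟩ := h'
  exact ⟨add_mem hx hy, by rw [map_add]; exact add_mem hdx hdy, rfl⟩

lemma FiltCx.IsCls.sub {n i : ℤ} {x y : A.cx.obj.X i} {e f : Coh (A.grCx n) i}
    (h : A.IsCls n i x e) (h' : A.IsCls n i y f) : A.IsCls n i (x - y) (e - f) := by
  obtain ⟨hx, hdx, rfl⟩ := h
  obtain ⟨hy, hdy, rfl⟩ := h'
  exact ⟨sub_mem hx hy, by rw [map_sub]; exact sub_mem hdx hdy, rfl⟩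

lemma FiltCx.isCls_zero_iff {n h i : ℤ} (hhi : h + 1 = i)
    {x : A.cx.obj.X i} : A.IsCls n i x 0 ↔
      ∃ z ∈ A.W n h, x - (A.cx.obj.d h i).hom z ∈ A.W (n - 1) i := by
  obtain rfl : h = i - 1 := by omega
  constructor
  · rintro ⟨hx, hdx, he⟩
    obtain ⟨z, hz⟩ := (Coh.mk_eq_zero _ _ _ _).1 he.symm
    obtain ⟨z, hzW, rfl⟩ := A.grMk_surj n _ z
    exact ⟨z, hzW, (A.grMk_eq n i x hx _ (A.biregular.map_d n (i - 1) i hzW)).1 hz.symm⟩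
  · rintro ⟨z, hz, hxz⟩
    have hdz := A.biregular.map_d n (i - 1) i hz
    have hx : x ∈ A.W n i := by
      have := add_mem (A.biregular.mono i (n - 1) n (by omega) hxz) hdz
      rwa [sub_add_cancel] at this
    have hdx : (A.cx.obj.d i (i + 1)).hom x ∈ A.W (n - 1) (i + 1) := by
      have := A.biregular.map_d (n - 1) i (i + 1) hxz
      rwa [Submodule.mem_comap, map_sub, d_d, sub_zero] at this
    refine ⟨hx, hdx, ((Coh.mk_eq_zero _ _ _ _).2 ⟨A.grMk n (i - 1) z hz, ?_⟩).symm⟩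
    exact ((A.grMk_eq n i x hx _ hdz).2 hxz).symm

lemma FiltCx.isCls_zero {n i : ℤ} {x : A.cx.obj.X i} (hx : x ∈ A.W (n - 1) i) :
    A.IsCls n i x 0 :=
  (FiltCx.isCls_zero_iff (h := i - 1) (by omega)).2 ⟨0, zero_mem _, by simpa using hx⟩

lemma FiltCx.isCls_d {n h i : ℤ} (hhi : h + 1 = i) {z : A.cx.obj.X h} (hz : z ∈ A.W n h) :
    A.IsCls n i ((A.cx.obj.d h i).hom z) 0 :=
  (FiltCx.isCls_zero_iff hhi).2 ⟨z, hz, by simp⟩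

lemma FiltCx.IsCls.unique {n i : ℤ} {x : A.cx.obj.X i} {e f : Coh (A.grCx n) i}
    (h : A.IsCls n i x e) (h' : A.IsCls n i x f) : e = f := by
  obtain ⟨hx, hdx, rfl⟩ := h
  obtain ⟨-, -, rfl⟩ := h'
  rfl

lemma FiltCx.IsCls.congr {n i : ℤ} {x y : A.cx.obj.X i} {e : Coh (A.grCx n) i}
    (h : A.IsCls n i x e) (hy : y - x ∈ A.W (n - 1) i) : A.IsCls n i y e := by
  have := (FiltCx.isCls_zero hy).add h
  rwa [sub_add_cancel, zero_add] at this

lemma FiltCx.isCls_surj (n i : ℤ) (e : Coh (A.grCx n) i) : ∃ x, A.IsCls n i x e := by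
  obtain ⟨x, hxc, rfl⟩ := Coh.mk_surj _ _ e
  obtain ⟨x, hxW, rfl⟩ := A.grMk_surj n i x
  exact ⟨x, hxW, (A.grMk_eq_zero n _ _ _).1 hxc, rfl⟩

lemma FiltCx.DRel.add {n m i j : ℤ} {e e' : Coh (A.grCx n) i} {u u' : Coh (A.grCx m) j}
    (h : A.DRel n m i j e u) (h' : A.DRel n m i j e' u') : A.DRel n m i j (e + e') (u + u') := by
  obtain ⟨x, hx, hdx⟩ := h
  obtain ⟨y, hy, hdy⟩ := h'
  exact ⟨x + y, hx.add hy, by rw [map_add]; exact hdx.add hdy⟩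

lemma FiltCx.DRel.sub {n m i j : ℤ} {e e' : Coh (A.grCx n) i} {u u' : Coh (A.grCx m) j}
    (h : A.DRel n m i j e u) (h' : A.DRel n m i j e' u') : A.DRel n m i j (e - e') (u - u') := by
  obtain ⟨x, hx, hdx⟩ := h
  obtain ⟨y, hy, hdy⟩ := h'
  exact ⟨x - y, hx.sub hy, by rw [map_sub]; exact hdx.sub hdy⟩

lemma FiltCx.DRel.zero (n m i j : ℤ) : A.DRel n m i j 0 0 :=
  ⟨0, FiltCx.isCls_zero (zero_mem _), by rw [map_zero]; exact FiltCx.isCls_zero (zero_mem _)⟩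

lemma FiltCx.RRel.sub {n i : ℤ} {h h' : Coh A.cx.obj i} {e e' : Coh (A.grCx n) i}
    (H : A.RRel n i h e) (H' : A.RRel n i h' e') : A.RRel n i (h - h') (e - e') := by
  obtain ⟨x, hx, rfl, hxe⟩ := H
  obtain ⟨y, hy, rfl, hye⟩ := H'
  exact ⟨x - y, by rw [map_sub, hx, hy, sub_zero], rfl, hxe.sub hye⟩

end Relations

/-! ### Filtered quasi-isomorphisms preserve and reflect the relations. -/

section Morphisms

variable {k : Type} [Field k] {K L : FiltCx.{u} k} {f : K ⟶ L}

lemma FiltCx.IsCls.map (f : K ⟶ L) {n i : ℤ} {x : K.cx.obj.X i} {e : Coh (K.grCx n) i}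
    (h : K.IsCls n i x e) :
    L.IsCls n i ((f.hom.hom.f i).hom x) (Coh.map (FiltCx.grCxMap f n) i e) := by
  obtain ⟨hx, hdx, rfl⟩ := h
  exact ⟨f.map_le n i hx, by rw [hom_comm]; exact f.map_le _ _ hdx, rfl⟩

lemma FiltCx.DRel.map (f : K ⟶ L) {n m i j : ℤ} {e : Coh (K.grCx n) i} {u : Coh (K.grCx m) j}
    (h : K.DRel n m i j e u) : L.DRel n m i j (Coh.map (FiltCx.grCxMap f n) i e)
      (Coh.map (FiltCx.grCxMap f m) j u) := by
  obtain ⟨x, hx, hdx⟩ := h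
  exact ⟨_, hx.map f, by rw [hom_comm]; exact hdx.map f⟩

lemma FiltCx.RRel.map (f : K ⟶ L) {n i : ℤ} {h : Coh K.cx.obj i} {e : Coh (K.grCx n) i}
    (H : K.RRel n i h e) : L.RRel n i (Coh.map f.hom.hom i h)
      (Coh.map (FiltCx.grCxMap f n) i e) := by
  obtain ⟨x, hx, rfl, hxe⟩ := H
  exact ⟨_, (hom_comm f.hom.hom i (i + 1) x).trans (by rw [hx, map_zero]), rfl, hxe.map f⟩

/-- A form of `gr_inj` in which the hypotheses hold only modulo $W_{n-1}$, as is needed for the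
quotients $W_n/W_m$. -/
lemma gr_inj_of_mem (hf : FiltCx.quasiIso k f) (n i j l : ℤ) (hij : i + 1 = j) (hjl : j + 1 = l)
    (x : K.cx.obj.X j) (hx : x ∈ K.W n j) (hdx : (K.cx.obj.d j l).hom x ∈ K.W (n - 1) l)
    (y : L.cx.obj.X i) (hy : y ∈ L.W n i)
    (hxy : (f.hom.hom.f j).hom x - (L.cx.obj.d i j).hom y ∈ L.W (n - 1) j) :
    ∃ z ∈ K.W n i, x - (K.cx.obj.d i j).hom z ∈ K.W (n - 1) j := by
  obtain ⟨e, he⟩ := FiltCx.exists_isCls hjl hx hdx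
  have h0 := (he.map f).unique ((FiltCx.isCls_zero_iff hij).2 ⟨y, hy, hxy⟩)
  have hs : Function.Injective (Coh.map (FiltCx.grCxMap f n) j) :=
    ((quasiIso_iff_bijective _).1 (hf n) j).1
  obtain rfl : e = 0 := hs (h0.trans (map_zero (Coh.map (FiltCx.grCxMap f n) j)).symm)
  exact (FiltCx.isCls_zero_iff hij).1 he

/-- Injectivity on the cohomology of `W_n / W_m` of a filtered quasi-isomorphism. -/
lemma filt_inj_of_mem (hf : FiltCx.quasiIso k f) (m n h i j l : ℤ) (hhi : h + 1 = i)
    (hij : i + 1 = j) (hjl : j + 1 = l) (hmn : m ≤ n)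
    (x : K.cx.obj.X j) (hx : x ∈ K.W n j) (hdx : (K.cx.obj.d j l).hom x ∈ K.W m l)
    (y : L.cx.obj.X i) (hy : y ∈ L.W n i)
    (hxy : (f.hom.hom.f j).hom x - (L.cx.obj.d i j).hom y ∈ L.W m j) :
    ∃ z ∈ K.W n i, x - (K.cx.obj.d i j).hom z ∈ K.W m j := by
  induction n, hmn using Int.leInduction generalizing x y with
  | base => exact ⟨0, zero_mem _, by simpa using hx⟩
  | succ n hn ih =>
    have e : n + 1 - 1 = n := by omega
    obtain ⟨z, hz, hx'⟩ := gr_inj_of_mem hf (n + 1) i j l hij hjl x hx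
      (K.biregular.mono _ _ _ (by omega) hdx) y hy (L.biregular.mono _ _ _ (by omega) hxy)
    rw [e] at hx'
    have hdx' : (K.cx.obj.d j l).hom (x - (K.cx.obj.d i j).hom z) = (K.cx.obj.d j l).hom x := by
      rw [map_sub, d_d, sub_zero]
    have hxy' : (f.hom.hom.f j).hom (x - (K.cx.obj.d i j).hom z) -
        (L.cx.obj.d i j).hom (y - (f.hom.hom.f i).hom z) ∈ L.W m j := by
      rw [map_sub, map_sub, hom_comm f.hom.hom i j z, sub_sub_sub_cancel_right]
      exact hxy
    set x' := x - (K.cx.obj.d i j).hom z with hx'_def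
    -- The element $y-fz$ need not lie in $W_n$, but its differential does, so it is a cocycle of
    -- $\mathrm{gr}_{n+1}$. Surjectivity there replaces it by some $w\in W_n$, at the cost of
    -- subtracting $dt$ from $x'$.
    obtain ⟨t, ht, hdt, v, hv, w, hw, hyw⟩ := gr_surj hf (n + 1) h i j hhi hij
      (y - (f.hom.hom.f i).hom z) (sub_mem hy (f.map_le _ _ hz)) (by
        have h1 : (f.hom.hom.f j).hom x' ∈ L.W n j := f.map_le n j hx'
        have h2 := sub_mem h1 (L.biregular.mono j m n hn hxy')
        rw [e]
        rwa [sub_sub_cancel] at h2)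
    rw [e] at hdt hw
    obtain ⟨z', hz', hxz⟩ := ih (x' - (K.cx.obj.d i j).hom t) (sub_mem hx' hdt)
      (by rw [map_sub, d_d, hdx', sub_zero]; exact hdx) w hw (by
        rw [hyw, map_add, map_add, d_d, hom_comm] at hxy'
        rw [map_sub]
        convert hxy' using 1
        abel)
    refine ⟨z + t + z', add_mem (add_mem hz ht) (K.biregular.mono _ _ _ (by omega) hz'), ?_⟩
    rw [hx'_def] at hxz
    rw [map_add, map_add]
    convert hxz using 1
    abel

/-- Surjectivity on the cohomology of `W_n / W_m` of a filtered quasi-isomorphism. -/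
lemma filt_surj_of_mem (hf : FiltCx.quasiIso k f) (m n i j l l' : ℤ) (hij : i + 1 = j)
    (hjl : j + 1 = l) (hll' : l + 1 = l') (hmn : m ≤ n)
    (y : L.cx.obj.X j) (hy : y ∈ L.W n j) (hdy : (L.cx.obj.d j l).hom y ∈ L.W m l) :
    ∃ x ∈ K.W n j, (K.cx.obj.d j l).hom x ∈ K.W m l ∧ ∃ v ∈ L.W n i, ∃ w ∈ L.W m j,
      y = (f.hom.hom.f j).hom x + (L.cx.obj.d i j).hom v + w := by
  induction n, hmn using Int.leInduction generalizing y with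
  | base => exact ⟨0, zero_mem _, by simp, 0, zero_mem _, y, hy, by simp⟩
  | succ n hn ih =>
    have e : n + 1 - 1 = n := by omega
    obtain ⟨x, hx, hdx, v, hv, w, hw, rfl⟩ := gr_surj hf (n + 1) i j l hij hjl y hy
      (L.biregular.mono _ _ _ (by omega) hdy)
    rw [e] at hdx hw
    have hdy' : (f.hom.hom.f l).hom ((K.cx.obj.d j l).hom x) - (L.cx.obj.d j l).hom (-w) ∈
        L.W m l := by
      rw [map_add, map_add, d_d, add_zero, hom_comm] at hdy
      rwa [map_neg, sub_neg_eq_add]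
    -- Modulo $W_m$, the element $f(dx)$ is the boundary of $-w\in W_n$. Injectivity one degree
    -- higher gives $z\in W_n$ with $dx-dz\in W_m$, so $x-z$ is a corrected lift and the error
    -- $w+fz$ lies in $W_n$.
    obtain ⟨z, hz, hxz⟩ := filt_inj_of_mem hf m n i j l l' hij hjl hll' hn _ hdx
      (by rw [d_d]; exact zero_mem _) (-w) (neg_mem hw) hdy'
    obtain ⟨x', hx', hdx', v', hv', w', hw', he⟩ := ih (w + (f.hom.hom.f j).hom z)
      (add_mem hw (f.map_le _ _ hz)) (by
        have := sub_mem hdy' (f.map_le m l hxz)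
        rw [map_sub, map_neg] at this
        rw [map_add, hom_comm]
        convert this using 1
        abel)
    refine ⟨x - z + x', add_mem (sub_mem hx (K.biregular.mono _ _ _ (by omega) hz))
      (K.biregular.mono _ _ _ (by omega) hx'), ?_, v + v',
      add_mem hv (L.biregular.mono _ _ _ (by omega) hv'), w', hw', ?_⟩
    · rw [map_add, map_sub]
      exact add_mem hxz hdx'
    · rw [eq_sub_of_add_eq he]
      simp only [map_add, map_sub]
      abel

/-- A witness $y$ is $fx+dv+w$ with $w\in W_m$. The term $dv$ is invisible on both sides, $w$
vanishes in $\mathrm{gr}_n$ because $m<n$, and $dw$ is a boundary in $\mathrm{gr}_m$. Hence $x$ is a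
witness upstairs. -/
lemma FiltCx.DRel.of_map (hf : FiltCx.quasiIso k f) {n m i j : ℤ} (hij : i + 1 = j) (hmn : m < n)
    {e : Coh (K.grCx n) i} {u : Coh (K.grCx m) j}
    (h : L.DRel n m i j (Coh.map (FiltCx.grCxMap f n) i e) (Coh.map (FiltCx.grCxMap f m) j u)) :
    K.DRel n m i j e u := by
  obtain ⟨y, hy, hdy⟩ := h
  obtain ⟨x, hx, hdx, v, hv, w, hw, rfl⟩ := filt_surj_of_mem hf m n (i - 1) i j (j + 1)
    (by omega) hij rfl hmn.le y hy.mem hdy.mem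
  obtain ⟨e', he'⟩ := FiltCx.exists_isCls hij hx (K.biregular.mono _ _ _ (by omega) hdx)
  obtain ⟨u', hu'⟩ := FiltCx.exists_isCls (n := m) (x := (K.cx.obj.d i j).hom x) rfl hdx
    (by rw [d_d]; exact zero_mem _)
  have hs (n i : ℤ) : Function.Injective (Coh.map (FiltCx.grCxMap f n) i) :=
    ((quasiIso_iff_bijective _).1 (hf n) i).1
  have h1 := hy.unique (((he'.map f).add (FiltCx.isCls_d (h := i - 1) (by omega) hv)).add
    (FiltCx.isCls_zero (L.biregular.mono _ _ _ (by omega) hw)))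
  have h2 := (hu'.map f).add (FiltCx.isCls_d (h := i) hij hw)
  rw [← hom_comm] at h2
  rw [map_add, map_add, d_d, add_zero] at hdy
  have h3 := hdy.unique h2
  rw [add_zero] at h3
  rw [add_zero, add_zero] at h1
  rw [hs n i h1, hs m j h3]
  exact ⟨x, he', hu'⟩

lemma FiltCx.RRel.of_map (hf : FiltCx.quasiIso k f) {n i : ℤ}
    {h : Coh K.cx.obj i} {e : Coh (K.grCx n) i}
    (H : L.RRel n i (Coh.map f.hom.hom i h) (Coh.map (FiltCx.grCxMap f n) i e)) :
    K.RRel n i h e := by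
  obtain ⟨y, hyc, hyh, hye⟩ := H
  obtain ⟨a, -, ha, -⟩ := L.biregular.finite i
  obtain ⟨a', -, ha', -⟩ := K.biregular.finite (i + 1)
  -- The bottom level must kill $W$ on both $L^i$ and $K^{i+1}$, so that $x$ is a cocycle and not
  -- only one modulo a step of $W$; it is also taken at most $n$.
  obtain ⟨x, hx, hdx, v, hv, rfl⟩ := filt_surj hf (min n (min a a')) n (i - 1) i (i + 1)
    (i + 1 + 1) (by omega) (by omega) (by omega)
    (eq_bot_iff.2 ((L.biregular.mono i _ _ (by omega)).trans ha.le))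
    (eq_bot_iff.2 ((K.biregular.mono _ _ _ (by omega)).trans ha'.le)) (by omega) y hye.mem hyc
  obtain ⟨e', he'⟩ := FiltCx.exists_isCls (n := n) rfl hx (by rw [hdx]; exact zero_mem _)
  have hs (n i : ℤ) : Function.Injective (Coh.map (FiltCx.grCxMap f n) i) :=
    ((quasiIso_iff_bijective _).1 (hf n) i).1
  have hs' : Function.Injective (Coh.map f.hom.hom i) :=
    ((quasiIso_iff_bijective _).1 (quasiIso_of_filtered hf) i).1
  have h1 := hye.unique ((he'.map f).add (FiltCx.isCls_d (h := i - 1) (by omega) hv))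
  rw [add_zero] at h1
  refine ⟨x, hdx, hs' (hyh.trans ?_), hs n i h1 ▸ he'⟩
  refine (Coh.mk_eq L.cx.obj i _ _ _ (by
    change (L.cx.obj.d i (i + 1)).hom ((f.hom.hom.f i).hom x) = 0
    rw [hom_comm, hdx, map_zero])).2 ⟨v, ?_⟩
  change _ = _ - (f.hom.hom.f i).hom x
  rw [add_sub_cancel_left]

end Morphisms

/-! ### Transport of the relations along morphisms of $D^+F$. -/

section Localized

variable {k : Type} [Field k]

/-- The filtered complex underlying an object of `D⁺F(k)`. -/
def DPlusF.toFiltCx (X : DPlusF.{u} k) : FiltCx.{u} k :=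
  (Localization.Construction.objEquiv (FiltCx.quasiIso.{u} k)).symm X

/-- The map induced on `H^i(gr^W_n)` by a morphism of `D⁺F(k)`. -/
def DPlusF.grCohMap {X Y : DPlusF.{u} k} (φ : X ⟶ Y) (n i : ℤ) :
    Coh (X.toFiltCx.grCx n) i →ₗ[k] Coh (Y.toFiltCx.grCx n) i :=
  ((DPlus.cohFunctor i).map ((DPlusF.gr n).map φ)).hom

/-- The map induced on `H^i` by a morphism of `D⁺F(k)`. -/
def DPlusF.cohMap {X Y : DPlusF.{u} k} (φ : X ⟶ Y) (i : ℤ) :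
    Coh X.toFiltCx.cx.obj i →ₗ[k] Coh Y.toFiltCx.cx.obj i :=
  ((DPlus.cohFunctor i).map (DPlusF.forget.map φ)).hom

lemma DPlusF.grCohMap_comp {X Y Z : DPlusF.{u} k} (φ : X ⟶ Y) (ψ : Y ⟶ Z) (n i : ℤ) :
    DPlusF.grCohMap (φ ≫ ψ) n i = DPlusF.grCohMap ψ n i ∘ₗ DPlusF.grCohMap φ n i :=
  congrArg ModuleCat.Hom.hom ((DPlusF.gr n ⋙ DPlus.cohFunctor i).map_comp φ ψ)

lemma DPlusF.cohMap_comp {X Y Z : DPlusF.{u} k} (φ : X ⟶ Y) (ψ : Y ⟶ Z) (i : ℤ) :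
    DPlusF.cohMap (φ ≫ ψ) i = DPlusF.cohMap ψ i ∘ₗ DPlusF.cohMap φ i :=
  congrArg ModuleCat.Hom.hom ((DPlusF.forget ⋙ DPlus.cohFunctor i).map_comp φ ψ)

lemma DPlusF.grCohMap_id (X : DPlusF.{u} k) (n i : ℤ) :
    DPlusF.grCohMap (𝟙 X) n i = LinearMap.id :=
  congrArg ModuleCat.Hom.hom ((DPlusF.gr n ⋙ DPlus.cohFunctor i).map_id X)

lemma DPlusF.cohMap_id (X : DPlusF.{u} k) (i : ℤ) :
    DPlusF.cohMap (𝟙 X) i = LinearMap.id :=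
  congrArg ModuleCat.Hom.hom ((DPlusF.forget ⋙ DPlus.cohFunctor i).map_id X)

lemma DPlus.cohFunctor_map_Q {K L : CochainComplex.Plus (ModuleCat.{u} k)} (f : K ⟶ L) (i : ℤ) :
    (DPlus.cohFunctor i).map (DPlus.Q.map f) = (InfHodge.cohFunctor i).map f.hom := by
  have := Functor.congr_hom (Localization.Construction.fac (W := CochainComplex.Plus.quasiIso _)
    (CochainComplex.Plus.ι (ModuleCat.{u} k) ⋙ InfHodge.cohFunctor i)
    (fun _ _ f hf => (ConcreteCategory.isIso_iff_bijective _).2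
      ((quasiIso_iff_bijective f).1 hf i))) f
  simpa using! this

lemma DPlusF.gr_map_Q {K L : FiltCx.{u} k} (f : K ⟶ L) (n : ℤ) :
    (DPlusF.gr n).map (DPlusF.Q.map f) = DPlus.Q.map ((FiltCx.gr n).map f) := by
  have := Functor.congr_hom (Localization.Construction.fac (W := FiltCx.quasiIso.{u} k)
    (FiltCx.gr n ⋙ DPlus.Q) (fun _ _ _ hf => MorphismProperty.Q_inverts _ _ (hf n))) f
  simpa using! this

lemma DPlusF.forget_map_Q {K L : FiltCx.{u} k} (f : K ⟶ L) :
    DPlusF.forget.map (DPlusF.Q.map f) = DPlus.Q.map (FiltCx.forget.map f) := by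
  have := Functor.congr_hom (Localization.Construction.fac (W := FiltCx.quasiIso.{u} k)
    (FiltCx.forget ⋙ DPlus.Q)
    (fun _ _ _ hf => MorphismProperty.Q_inverts _ _ (quasiIso_of_filtered hf))) f
  simpa using! this

lemma DPlusF.grCohMap_Q {K L : FiltCx.{u} k} (f : K ⟶ L) (n i : ℤ) :
    DPlusF.grCohMap (DPlusF.Q.map f) n i = Coh.map (FiltCx.grCxMap f n) i :=
  congrArg ModuleCat.Hom.hom ((congrArg (DPlus.cohFunctor i).map (DPlusF.gr_map_Q f n)).trans
    (DPlus.cohFunctor_map_Q ((FiltCx.gr n).map f) i))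

lemma DPlusF.cohMap_Q {K L : FiltCx.{u} k} (f : K ⟶ L) (i : ℤ) :
    DPlusF.cohMap (DPlusF.Q.map f) i = Coh.map f.hom.hom i :=
  congrArg ModuleCat.Hom.hom ((congrArg (DPlus.cohFunctor i).map (DPlusF.forget_map_Q f)).trans
    (DPlus.cohFunctor_map_Q (FiltCx.forget.map f) i))

lemma DPlusF.grCohMap_wInv {K L : FiltCx.{u} k} (f : K ⟶ L) (hf : FiltCx.quasiIso k f) (n i : ℤ)
    (e : Coh (L.grCx n) i) : Coh.map (FiltCx.grCxMap f n) i
      (DPlusF.grCohMap (Localization.Construction.wInv f hf) n i e) = e := by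
  have h1 := DPlusF.grCohMap_comp (Localization.Construction.wInv f hf) (DPlusF.Q.map f) n i
  have h2 : DPlusF.grCohMap (Localization.Construction.wInv f hf ≫ DPlusF.Q.map f) n i =
      LinearMap.id :=
    (congrArg (fun φ => DPlusF.grCohMap φ n i)
      (Localization.Construction.wIso f hf).inv_hom_id).trans (DPlusF.grCohMap_id _ n i)
  rw [DPlusF.grCohMap_Q, h2] at h1
  exact (LinearMap.congr_fun h1 e).symm

lemma DPlusF.cohMap_wInv {K L : FiltCx.{u} k} (f : K ⟶ L) (hf : FiltCx.quasiIso k f) (i : ℤ)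
    (h : Coh L.cx.obj i) : Coh.map f.hom.hom i
      (DPlusF.cohMap (Localization.Construction.wInv f hf) i h) = h := by
  have h1 := DPlusF.cohMap_comp (Localization.Construction.wInv f hf) (DPlusF.Q.map f) i
  have h2 : DPlusF.cohMap (Localization.Construction.wInv f hf ≫ DPlusF.Q.map f) i =
      LinearMap.id :=
    (congrArg (fun φ => DPlusF.cohMap φ i)
      (Localization.Construction.wIso f hf).inv_hom_id).trans (DPlusF.cohMap_id _ i)
  rw [DPlusF.cohMap_Q, h2] at h1
  exact (LinearMap.congr_fun h1 h).symm

/-- Every morphism of the localization is a composite of images of filtered morphisms and of formal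
inverses of filtered quasi-isomorphisms. -/
lemma DPlusF.induction {P : ∀ {X Y : DPlusF.{u} k}, (X ⟶ Y) → Prop}
    (hcomp : ∀ {X Y Z : DPlusF.{u} k} (φ : X ⟶ Y) (ψ : Y ⟶ Z), P φ → P ψ → P (φ ≫ ψ))
    (hQ : ∀ {K L : FiltCx.{u} k} (f : K ⟶ L), P (DPlusF.Q.map f))
    (hinv : ∀ {K L : FiltCx.{u} k} (f : K ⟶ L) (hf : FiltCx.quasiIso k f),
      P (Localization.Construction.wInv f hf))
    {X Y : DPlusF.{u} k} (φ : X ⟶ Y) : P φ := by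
  let P' : MorphismProperty (DPlusF.{u} k) := fun _ _ φ => P φ
  have : P'.IsStableUnderComposition := ⟨fun φ ψ h h' => hcomp φ ψ h h'⟩
  have h := Localization.Construction.morphismProperty_eq_top P' (fun _ _ f => hQ f)
    (fun _ _ f hf => hinv f hf)
  have h' : P' φ := by rw [h]; trivial
  exact h'

/-- A formal inverse is handled by reflecting the relation through the quasi-isomorphism that it
inverts, which is where $m<n$ is used. -/
lemma DPlusF.dRel_map {X Y : DPlusF.{u} k} (φ : X ⟶ Y) {n m i j : ℤ} (hij : i + 1 = j)
    (hmn : m < n) {e : Coh (X.toFiltCx.grCx n) i} {u : Coh (X.toFiltCx.grCx m) j}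
    (h : X.toFiltCx.DRel n m i j e u) :
    Y.toFiltCx.DRel n m i j (DPlusF.grCohMap φ n i e) (DPlusF.grCohMap φ m j u) := by
  refine DPlusF.induction (P := fun {X Y} φ => ∀ (e : Coh (X.toFiltCx.grCx n) i)
    (u : Coh (X.toFiltCx.grCx m) j), X.toFiltCx.DRel n m i j e u →
    Y.toFiltCx.DRel n m i j (DPlusF.grCohMap φ n i e) (DPlusF.grCohMap φ m j u))
    ?_ ?_ ?_ φ e u h
  · intro X Y Z φ ψ hφ hψ e u h
    rw [DPlusF.grCohMap_comp, DPlusF.grCohMap_comp]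
    exact hψ _ _ (hφ _ _ h)
  · intro K L f e u h
    rw [DPlusF.grCohMap_Q, DPlusF.grCohMap_Q]
    exact FiltCx.DRel.map f h
  · intro K L f hf e u h
    have h1 := DPlusF.grCohMap_wInv f hf n i e
    have h2 := DPlusF.grCohMap_wInv f hf m j u
    refine FiltCx.DRel.of_map hf hij hmn ?_
    rw [h1, h2]
    exact h

lemma DPlusF.rRel_map {X Y : DPlusF.{u} k} (φ : X ⟶ Y) {n i : ℤ}
    {h : Coh X.toFiltCx.cx.obj i} {e : Coh (X.toFiltCx.grCx n) i} (H : X.toFiltCx.RRel n i h e) :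
    Y.toFiltCx.RRel n i (DPlusF.cohMap φ i h) (DPlusF.grCohMap φ n i e) := by
  refine DPlusF.induction (P := fun {X Y} φ => ∀ (h : Coh X.toFiltCx.cx.obj i)
    (e : Coh (X.toFiltCx.grCx n) i), X.toFiltCx.RRel n i h e →
    Y.toFiltCx.RRel n i (DPlusF.cohMap φ i h) (DPlusF.grCohMap φ n i e))
    ?_ ?_ ?_ φ h e H
  · intro X Y Z φ ψ hφ hψ e u h
    rw [DPlusF.grCohMap_comp, DPlusF.cohMap_comp]
    exact hψ _ _ (hφ _ _ h)
  · intro K L f e u h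
    rw [DPlusF.grCohMap_Q, DPlusF.cohMap_Q]
    exact FiltCx.RRel.map f h
  · intro K L f hf h e H
    have h1 := DPlusF.grCohMap_wInv f hf n i e
    have h2 := DPlusF.cohMap_wInv f hf i h
    refine FiltCx.RRel.of_map hf ?_
    rw [h1, h2]
    exact H

end Localized

/-! ### Pure first page: the differential $d_1$ and strictness. -/

section Core

variable {k : Type} [Field k] {A : FiltCx.{u} k} {F : ℤ → ∀ i : ℤ, Submodule k (A.cx.obj.X i)}
  {σ : ∀ n i : ℤ, Coh (A.grCx n) i →+ Coh (A.grCx n) i}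

variable (A F) in
/-- The filtration induced by `F` on `H^i(gr^W_n A)`. -/
def FiltCx.FCls (n p i : ℤ) (e : Coh (A.grCx n) i) : Prop := ∃ x ∈ F p i, A.IsCls n i x e

variable (A F) in
/-- The filtration induced by `F` on `H^i(A)`. -/
def FiltCx.FCoh (p i : ℤ) (h : Coh A.cx.obj i) : Prop :=
  ∃ x hx, x ∈ F p i ∧ h = Coh.mk A.cx.obj i x hx

variable (A) in
/-- The filtration induced by `W` on `H^i(A)`. -/
def FiltCx.WCoh (n i : ℤ) (h : Coh A.cx.obj i) : Prop :=
  ∃ x hx, x ∈ A.W n i ∧ h = Coh.mk A.cx.obj i x hx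

variable (A F σ) in
/-- The first page of the weight spectral sequence of `(A, W, F)` consists of Hodge structures
with conjugations `σ` which are respected by all the differentials. -/
structure FiltCx.IsPure : Prop where
  biregular : IsDecreasingBiregular A.cx.obj F
  strict : ∀ {n p i j : ℤ}, i + 1 = j → ∀ {y z}, y ∈ F p j → y ∈ A.W n j → z ∈ A.W n i →
    y - (A.cx.obj.d i j).hom z ∈ A.W (n - 1) j →
    ∃ z' ∈ F p i, z' ∈ A.W n i ∧ y - (A.cx.obj.d i j).hom z' ∈ A.W (n - 1) j
  invol : ∀ n i e, σ n i (σ n i e) = e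
  dRel : ∀ {n m i j : ℤ}, i + 1 = j → m < n → ∀ {e u}, A.DRel n m i j e u →
    A.DRel n m i j (σ n i e) (σ m j u)
  split : ∀ {n a b i : ℤ}, a + b = n + i + 1 → ∀ e : Coh (A.grCx n) i,
    ∃ f g, e = f + g ∧ A.FCls F n a i f ∧ A.FCls F n b i (σ n i g)
  disjoint : ∀ {n a b i : ℤ}, a + b = n + i + 1 → ∀ e : Coh (A.grCx n) i,
    A.FCls F n a i e → A.FCls F n b i (σ n i e) → e = 0

variable {n m p a b i j : ℤ}

lemma FiltCx.FCls.add {e f : Coh (A.grCx n) i} (he : A.FCls F n p i e) (hf : A.FCls F n p i f) :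
    A.FCls F n p i (e + f) := by
  obtain ⟨x, hx, hxe⟩ := he
  obtain ⟨y, hy, hyf⟩ := hf
  exact ⟨x + y, add_mem hx hy, hxe.add hyf⟩

lemma FiltCx.FCls.sub {e f : Coh (A.grCx n) i} (he : A.FCls F n p i e) (hf : A.FCls F n p i f) :
    A.FCls F n p i (e - f) := by
  obtain ⟨x, hx, hxe⟩ := he
  obtain ⟨y, hy, hyf⟩ := hf
  exact ⟨x - y, sub_mem hx hy, hxe.sub hyf⟩

lemma FiltCx.FCls.zero : A.FCls F n p i 0 := ⟨0, zero_mem _, FiltCx.isCls_zero (zero_mem _)⟩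

/-- For consecutive indices the relation is single-valued, that is, it is the map $d_1$: if $x-dz\in
W_m$, then $dx=d(x-dz)$ is a boundary in $\mathrm{gr}_m$. -/
lemma FiltCx.DRel.eq_zero (hij : i + 1 = j) {u : Coh (A.grCx m) j}
    (h : A.DRel (m + 1) m i j 0 u) : u = 0 := by
  obtain ⟨x, hx, hdx⟩ := h
  obtain ⟨z, hz, hxz⟩ := (FiltCx.isCls_zero_iff (h := i - 1) (by omega)).1 hx
  rw [add_sub_cancel_right] at hxz
  have := FiltCx.isCls_d hij hxz
  rw [map_sub, d_d, sub_zero] at this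
  exact hdx.unique this

lemma FiltCx.DRel.unique (hij : i + 1 = j) {e : Coh (A.grCx (m + 1)) i} {u u' : Coh (A.grCx m) j}
    (h : A.DRel (m + 1) m i j e u) (h' : A.DRel (m + 1) m i j e u') : u = u' := by
  have := h.sub h'
  rw [sub_self] at this
  exact sub_eq_zero.1 (this.eq_zero hij)

lemma FiltCx.exists_dRel (hij : i + 1 = j) (e : Coh (A.grCx (m + 1)) i) :
    ∃ u, A.DRel (m + 1) m i j e u := by
  obtain ⟨x, hx⟩ := A.isCls_surj _ _ e
  obtain ⟨u, hu⟩ := FiltCx.exists_isCls (n := m) (x := (A.cx.obj.d i j).hom x) rfl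
    (A.biregular.mono _ _ _ (by omega) (hx.d_mem hij)) (by rw [d_d]; exact zero_mem _)
  exact ⟨u, x, hx, hu⟩

/-- Any class on which a longer differential is defined lies in $\ker d_1$, because $dx\in
W_m\subseteq W_{n-2}$. -/
lemma FiltCx.DRel.to_one (hmn : m + 1 < n) {e : Coh (A.grCx n) i}
    {u : Coh (A.grCx m) j} (h : A.DRel n m i j e u) : A.DRel n (n - 1) i j e 0 := by
  obtain ⟨x, hx, hdx⟩ := h
  exact ⟨x, hx, FiltCx.isCls_zero (A.biregular.mono _ _ _ (by omega) hdx.mem)⟩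

namespace FiltCx.IsPure

variable (H : A.IsPure F σ)
include H

lemma fCls_mono (hab : a ≤ b) {e : Coh (A.grCx n) i} (he : A.FCls F n b i e) :
    A.FCls F n a i e := by
  obtain ⟨x, hx, hxe⟩ := he
  exact ⟨x, H.biregular.anti _ _ _ hab hx, hxe⟩

lemma fCls_dRel (hij : i + 1 = j) {e : Coh (A.grCx (m + 1)) i} {u : Coh (A.grCx m) j}
    (he : A.FCls F (m + 1) p i e) (h : A.DRel (m + 1) m i j e u) : A.FCls F m p j u := by
  obtain ⟨x, hx, hxe⟩ := he
  obtain ⟨u', hu'⟩ := FiltCx.exists_isCls (n := m) (x := (A.cx.obj.d i j).hom x) rfl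
    (A.biregular.mono _ _ _ (by omega) (hxe.d_mem hij)) (by rw [d_d]; exact zero_mem _)
  have : A.DRel (m + 1) m i j e u' := ⟨x, hxe, hu'⟩
  rw [h.unique hij this]
  exact ⟨_, H.biregular.map_d p i j hx, hu'⟩

/-- The differential `d_1`, a morphism of Hodge structures, is strictly compatible with `F`. -/
lemma strict_dRel (hij : i + 1 = j) {e : Coh (A.grCx (m + 1)) i} {u : Coh (A.grCx m) j}
    (h : A.DRel (m + 1) m i j e u) (hu : A.FCls F m p j u) :
    ∃ e', A.FCls F (m + 1) p i e' ∧ A.DRel (m + 1) m i j e' u := by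
  obtain ⟨f, g, rfl, hf, hg⟩ := H.split (b := m + 1 + i + 1 - p) (add_sub_cancel _ _) e
  obtain ⟨v, hv⟩ := FiltCx.exists_dRel hij f
  obtain ⟨w, hw⟩ := FiltCx.exists_dRel hij g
  obtain rfl := h.unique hij (hv.add hw)
  -- Here $w=d_1g$ is in the conjugate of $F^{m+i+2-p}$, and $w=u-d_1f$ is in $F^p$. The indices add
  -- up to one more than the weight $m+j=m+i+1$, so $w=0$ and $f$ alone has image $u$.
  have h0 : w = 0 := by
    refine H.disjoint (a := p) (b := m + 1 + i + 1 - p) (by omega) w ?_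
      (H.fCls_dRel hij hg (H.dRel hij (by omega) hw))
    have := hu.sub (H.fCls_dRel hij hf hv)
    rwa [add_sub_cancel_left] at this
  rw [h0, add_zero]
  exact ⟨f, hf, hv⟩

/-- The components of a class in the kernel of `d_1` are in the kernel of `d_1`. -/
lemma split_ker (hij : i + 1 = j) (hmn : m + 1 = n) (hab : a + b = n + i + 1)
    {f g : Coh (A.grCx n) i} (h : A.DRel n m i j (f + g) 0) (hf : A.FCls F n a i f)
    (hg : A.FCls F n b i (σ n i g)) : A.DRel n m i j f 0 ∧ A.DRel n m i j g 0 := by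
  subst hmn
  obtain ⟨v, hv⟩ := FiltCx.exists_dRel hij f
  obtain ⟨w, hw⟩ := FiltCx.exists_dRel hij g
  have h1 : v + w = 0 := ((hv.add hw).unique hij h)
  -- Since $d_1f=-d_1g$ lies in $F^a$ and in the conjugate of $F^b$, and $d_1$ keeps the weight, it
  -- vanishes.
  have h0 : w = 0 := by
    refine H.disjoint (a := a) (b := b) (by omega) w ?_
      (H.fCls_dRel hij hg (H.dRel hij (by omega) hw))
    rw [eq_neg_of_add_eq_zero_right h1, ← zero_sub]
    exact FiltCx.FCls.zero.sub (H.fCls_dRel hij hf hv)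
  subst h0
  rw [add_zero] at h1
  subst h1
  exact ⟨hv, hw⟩

/-- This is disjointness of $F$ and $\bar F$ above the weight on $E_2$, without forming $E_2$.
Writing $u-v=d_1f+d_1g$ with $f\in F^a$ and $g$ in the complementary conjugate step, $u-d_1f=v+d_1g$
lies in both filtrations on $E_1$ and is zero. -/
lemma mem_range_of_sub_mem_range (hij : i + 1 = j) (hab : m + j + 1 ≤ a + b)
    {e : Coh (A.grCx (m + 1)) i} {u v : Coh (A.grCx m) j} (h : A.DRel (m + 1) m i j e (u - v))
    (hu : A.FCls F m a j u) (hv : A.FCls F m b j (σ m j v)) :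
    ∃ e', A.DRel (m + 1) m i j e' u := by
  obtain ⟨f, g, rfl, hf, hg⟩ := H.split (b := m + 1 + i + 1 - a) (add_sub_cancel _ _) e
  obtain ⟨v', hv'⟩ := FiltCx.exists_dRel hij f
  obtain ⟨w, hw⟩ := FiltCx.exists_dRel hij g
  have h1 := h.unique hij (hv'.add hw)
  have h2 : u - v' = v + w := by rw [sub_eq_iff_eq_add] at h1 ⊢; rw [h1]; abel
  have h0 : u - v' = 0 := by
    refine H.disjoint (a := a) (b := m + 1 + i + 1 - a) (by omega) _
      (hu.sub (H.fCls_dRel hij hf hv')) ?_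
    rw [h2, map_add]
    exact (H.fCls_mono (by omega) hv).add (H.fCls_dRel hij hg (H.dRel hij (by omega) hw))
  rw [sub_eq_zero.1 h0]
  exact ⟨f, hv'⟩

/-- Strictness of the differential of `F` on the second page. -/
lemma strict_two (hij : i + 1 = j) {y : A.cx.obj.X j} {w : A.cx.obj.X i} (hyF : y ∈ F p j)
    (hy : y ∈ A.W m j) (hw : w ∈ A.W (m + 1) i)
    (hyw : y - (A.cx.obj.d i j).hom w ∈ A.W (m - 1) j) :
    ∃ w' ∈ F p i, w' ∈ A.W (m + 1) i ∧ y - (A.cx.obj.d i j).hom w' ∈ A.W (m - 1) j := by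
  have hdw : (A.cx.obj.d i j).hom w ∈ A.W m j := by
    have := sub_mem hy (A.biregular.mono j _ m (by omega) hyw)
    rwa [sub_sub_cancel] at this
  obtain ⟨e, he⟩ := FiltCx.exists_isCls (n := m + 1) hij hw
    (A.biregular.mono _ _ _ (by omega) hdw)
  obtain ⟨u, hu⟩ := FiltCx.exists_isCls (n := m) (x := (A.cx.obj.d i j).hom w) rfl hdw
    (by rw [d_d]; exact zero_mem _)
  have hyu := hu.congr hyw
  -- Strictness of $d_1$ gives $x\in F^p\cap W_{m+1}$ with $dx$ and $y$ of the same class in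
  -- $H^j(\mathrm{gr}_m)$. The remainder $y-dx$ is a boundary in $\mathrm{gr}_m$, and strictness of
  -- $d_0$ lifts it within $F^p$.
  obtain ⟨e', ⟨x, hxF, hx⟩, he'⟩ := H.strict_dRel hij ⟨w, he, hu⟩ ⟨y, hyF, hyu⟩
  obtain ⟨x', hx', hdx'⟩ := he'
  obtain ⟨u', hu'⟩ := FiltCx.exists_isCls (n := m) (x := (A.cx.obj.d i j).hom x) rfl
    (A.biregular.mono _ _ _ (by omega) (hx.d_mem hij)) (by rw [d_d]; exact zero_mem _)
  obtain rfl : u = u' := FiltCx.DRel.unique hij ⟨x', hx', hdx'⟩ ⟨x, hx, hu'⟩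
  have h0 := hyu.sub hu'
  rw [sub_self] at h0
  obtain ⟨z, hz, hyz⟩ := (FiltCx.isCls_zero_iff hij).1 h0
  obtain ⟨z', hzF, hz', hyz'⟩ := H.strict hij
    (sub_mem hyF (H.biregular.map_d p i j hxF)) h0.mem hz hyz
  refine ⟨x + z', add_mem hxF hzF, add_mem hx.mem (A.biregular.mono _ _ _ (by omega) hz'), ?_⟩
  rwa [map_add, ← sub_sub]

end FiltCx.IsPure

variable (A) in
/-- The differentials `d_r` of the spectral sequence of `(A, W)` vanish, in terms of the
underlying additive relation. -/
def FiltCx.Deg (r : ℤ) : Prop := ∀ ⦃n m i j : ℤ⦄, m + r = n → i + 1 = j →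
  ∀ e u, A.DRel n m i j e u → ∃ e', A.DRel (m + 1) m i j e' u

/-- The form in which vanishing of $d_r$ is used: $dx$ can be pushed one step deeper into $W$ by
subtracting an element of $W_{m+1}$. -/
lemma FiltCx.Deg.exists {r : ℤ} (h : A.Deg r) (hr : 2 ≤ r) (hmn : m + r = n) (hij : i + 1 = j)
    {x : A.cx.obj.X i} (hx : x ∈ A.W n i) (hdx : (A.cx.obj.d i j).hom x ∈ A.W m j) :
    ∃ z ∈ A.W (m + 1) i, (A.cx.obj.d i j).hom (x - z) ∈ A.W (m - 1) j := by
  obtain ⟨e, he⟩ := FiltCx.exists_isCls hij hx (A.biregular.mono _ _ _ (by omega) hdx)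
  obtain ⟨u, hu⟩ := FiltCx.exists_isCls (n := m) (x := (A.cx.obj.d i j).hom x) rfl hdx
    (by rw [d_d]; exact zero_mem _)
  obtain ⟨e', z, hz, hdz⟩ := h hmn hij e u ⟨x, he, hu⟩
  have h0 := hu.sub hdz
  rw [sub_self] at h0
  obtain ⟨t, ht, hxt⟩ := (FiltCx.isCls_zero_iff hij).1 h0
  refine ⟨z + t, add_mem hz.mem (A.biregular.mono _ _ _ (by omega) ht), ?_⟩
  rwa [map_sub, map_add, ← sub_sub]

/-! ### Degeneration at $E_2$, page by page. -/

namespace FiltCx.IsPure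

variable (H : A.IsPure F σ)
include H

/-- Vanishing of $d_s$ corrects $x$ by some $z\in W_{n-s+1}$, possibly outside $F^p$; `strict_two`
replaces $z$ by an element of $F^p$. As $s\ge 2$, the corrections stay in $W_{n-1}$ and do not
change the class of $x$. -/
lemma exists_d_mem {r : ℤ} (hr : 2 ≤ r) (hD : ∀ s, 2 ≤ s → s < r → A.Deg s) (hij : i + 1 = j)
    {x : A.cx.obj.X i} (hxF : x ∈ F p i) (hx : x ∈ A.W n i)
    (hdx : (A.cx.obj.d i j).hom x ∈ A.W (n - 2) j) :
    ∃ x' ∈ F p i, x' ∈ A.W n i ∧ x - x' ∈ A.W (n - 1) i ∧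
      (A.cx.obj.d i j).hom x' ∈ A.W (n - r) j := by
  induction r, hr using Int.leInduction with
  | base => exact ⟨x, hxF, hx, by simp, hdx⟩
  | succ r hr ih =>
    obtain ⟨x', hxF', hx', hxx', hdx'⟩ := ih (fun s h h' => hD s h (by omega))
    obtain ⟨z, hz, hxz⟩ := (hD r hr (by omega)).exists hr (sub_add_cancel _ _) hij hx' hdx'
    rw [map_sub] at hxz
    obtain ⟨w, hwF, hw, hxw⟩ := H.strict_two hij (H.biregular.map_d p i j hxF') hdx' hz hxz
    refine ⟨x' - w, sub_mem hxF' hwF, sub_mem hx' (A.biregular.mono _ _ _ (by omega) hw), ?_, ?_⟩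
    · rw [← sub_add]
      exact add_mem hxx' (A.biregular.mono _ _ _ (by omega) hw)
    · rw [map_sub]
      exact A.biregular.mono _ _ _ (by omega) hxw

/-- The key to compatibility of $d_r$ with $F$: membership in $F^p$ on $E_1$ and survival to $E_r$
are achieved by one representative. Strictness of $d_0$ first brings $dx$ into $W_{n-2}$, and
`exists_d_mem` does the rest. -/
lemma exists_rep {r : ℤ} (hr : 2 ≤ r) (hD : ∀ s, 2 ≤ s → s < r → A.Deg s) (hij : i + 1 = j)
    {e : Coh (A.grCx n) i} (heF : A.FCls F n p i e) (he : A.DRel n (n - 1) i j e 0) :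
    ∃ x ∈ F p i, A.IsCls n i x e ∧ (A.cx.obj.d i j).hom x ∈ A.W (n - r) j := by
  obtain ⟨x, hxF, hx⟩ := heF
  have hdx := hx.d_mem hij
  obtain ⟨m, rfl⟩ : ∃ m, n = m + 1 := ⟨n - 1, by omega⟩
  have e1 : m + 1 - 1 = m := by omega
  rw [e1] at hdx he
  obtain ⟨u, hu⟩ := FiltCx.exists_isCls (n := m) (x := (A.cx.obj.d i j).hom x) rfl hdx
    (by rw [d_d]; exact zero_mem _)
  obtain rfl : u = 0 := FiltCx.DRel.unique hij ⟨x, hx, hu⟩ he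
  obtain ⟨z, hz, hxz⟩ := (FiltCx.isCls_zero_iff hij).1 hu
  obtain ⟨z', hzF', hz', hxz'⟩ := H.strict hij (H.biregular.map_d p i j hxF) hdx hz hxz
  have hx' : A.IsCls (m + 1) i (x - z') e := hx.congr (by
    rw [sub_sub_cancel_left, e1]; exact neg_mem hz')
  obtain ⟨x', hxF', -, hxx', hdx'⟩ := H.exists_d_mem hr hD hij (sub_mem hxF hzF') hx'.mem
    (by rw [map_sub]; exact A.biregular.mono _ _ _ (by omega) hxz')
  have hxx'' := neg_mem hxx'
  rw [neg_sub] at hxx''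
  exact ⟨x', hxF', hx'.congr hxx'', hdx'⟩

lemma exists_dRel_fCls {r : ℤ} (hr : 2 ≤ r) (hD : ∀ s, 2 ≤ s → s < r → A.Deg s)
    (hij : i + 1 = j) (hmn : m + r = n) {e : Coh (A.grCx n) i} (heF : A.FCls F n p i e)
    (he : A.DRel n (n - 1) i j e 0) : ∃ u, A.FCls F m p j u ∧ A.DRel n m i j e u := by
  obtain rfl : m = n - r := by omega
  obtain ⟨x, hxF, hx, hdx⟩ := H.exists_rep hr hD hij heF he
  obtain ⟨u, hu⟩ := FiltCx.exists_isCls (n := n - r) (x := (A.cx.obj.d i j).hom x) rfl hdx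
    (by rw [d_d]; exact zero_mem _)
  exact ⟨u, ⟨_, H.biregular.map_d p i j hxF, hu⟩, x, hx, hu⟩

omit H in
-- This bounds the indeterminacy of $d_r$. A representative of zero is $dz$ plus an element of
-- $W_{n-1}$, so $u$ is a value of $d_{r-1}$: for $r=2$ this is $d_1$, otherwise `Deg (r - 1)`
-- applies.
lemma mem_range_of_zero {r : ℤ} (hr : 2 ≤ r) (hD : ∀ s, 2 ≤ s → s < r → A.Deg s)
    (hij : i + 1 = j) (hmn : m + r = n) {u : Coh (A.grCx m) j} (h : A.DRel n m i j 0 u) :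
    ∃ e, A.DRel (m + 1) m i j e u := by
  obtain ⟨x, hx, hdx⟩ := h
  obtain ⟨z, hz, hxz⟩ := (FiltCx.isCls_zero_iff (h := i - 1) (by omega)).1 hx
  have hd : (A.cx.obj.d i j).hom (x - (A.cx.obj.d (i - 1) i).hom z) = (A.cx.obj.d i j).hom x := by
    rw [map_sub, d_d, sub_zero]
  rw [← hd] at hdx
  obtain ⟨e, he⟩ := FiltCx.exists_isCls hij hxz (A.biregular.mono _ _ _ (by omega) hdx.mem)
  have h1 : A.DRel (n - 1) m i j e u := ⟨_, he, hdx⟩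
  rcases hr.eq_or_lt with rfl | hr
  · obtain rfl : m = n - 1 - 1 := by omega
    rw [sub_add_cancel]
    exact ⟨e, h1⟩
  · exact hD (r - 1) (by omega) (by omega) (by omega) hij e u h1

/-- Descending along $F$ reduces to a class $g$ in $F^a\cap\bar F^{\,n+i-a}$. Its $d_r$ can be
computed with representatives in $F$ or in the conjugate filtration; the two values agree modulo
$\operatorname{im}d_1$, and their indices exceed the weight of the target. -/
lemma deg_step {r : ℤ} (hr : 2 ≤ r) (hD : ∀ s, 2 ≤ s → s < r → A.Deg s) : A.Deg r := by
  intro n m i j hmn hij e u h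
  obtain ⟨a₀, b₀, ha₀, hb₀⟩ := H.biregular.finite i
  -- It is enough to find one value of $d_r$ on $e$ in the image of $d_1$, since two values differ
  -- by a value on $0$. The number $N$ bounds the distance from $a$ to an index where $F$ vanishes.
  have key : ∀ N : ℕ, ∀ a : ℤ, b₀ ≤ a + N → ∀ e : Coh (A.grCx n) i, A.FCls F n a i e →
      A.DRel n (n - 1) i j e 0 → ∃ u, A.DRel n m i j e u ∧ ∃ e', A.DRel (m + 1) m i j e' u := by
    intro N
    induction N with
    | zero =>
      rintro a ha e ⟨x, hxF, hx⟩ -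
      have : x ∈ F b₀ i := H.biregular.anti _ _ _ (by simpa using ha) hxF
      rw [hb₀, Submodule.mem_bot] at this
      subst this
      obtain rfl := hx.unique (FiltCx.isCls_zero (zero_mem _))
      exact ⟨0, FiltCx.DRel.zero .., 0, FiltCx.DRel.zero ..⟩
    | succ N ih =>
      intro a ha e heF he
      push_cast at ha
      obtain ⟨f, g, rfl, hf, hg⟩ := H.split (a := a + 1) (b := n + i - a) (by omega) e
      obtain ⟨hf0, hg0⟩ := H.split_ker hij (by omega) (by omega) he hf hg
      obtain ⟨v, hv, e', he'⟩ := ih (a + 1) (by omega) f hf hf0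
      have hgF : A.FCls F n a i g := by
        have := heF.sub (H.fCls_mono (by omega) hf)
        rwa [add_sub_cancel_left] at this
      obtain ⟨w, hwF, hw⟩ := H.exists_dRel_fCls hr hD hij hmn hgF hg0
      have hσg0 := H.dRel hij (by omega) hg0
      rw [map_zero] at hσg0
      obtain ⟨w', hwF', hw'⟩ := H.exists_dRel_fCls hr hD hij hmn hg hσg0
      -- The value $w'$ was computed for $\sigma g$; conjugating back gives a second value $\sigma
      -- w'$ of $d_r$ on $g$.
      have hw'' := H.dRel hij (by omega) hw'
      rw [H.invol] at hw''
      have h0 := hw.sub hw''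
      rw [sub_self] at h0
      obtain ⟨e₁, he₁⟩ := mem_range_of_zero hr hD hij hmn h0
      -- The inequality needed is $n+i\ge m+j+1=n-r+i+2$, which is exactly $r\ge 2$.
      obtain ⟨e₂, he₂⟩ := H.mem_range_of_sub_mem_range hij (a := a) (b := n + i - a) (by omega)
        he₁ hwF (by rwa [H.invol])
      exact ⟨v + w, hv.add hw, e' + e₂, he'.add he₂⟩
  obtain ⟨x, hx⟩ := A.isCls_surj n i e
  obtain ⟨u', hu', e', he'⟩ := key (b₀ - a₀).toNat a₀ (by omega) e
    ⟨x, by rw [ha₀]; trivial, hx⟩ (h.to_one (by omega))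
  have h0 := h.sub hu'
  rw [sub_self] at h0
  obtain ⟨e₁, he₁⟩ := mem_range_of_zero hr hD hij hmn h0
  have := he₁.add he'
  rw [sub_add_cancel] at this
  exact ⟨_, this⟩

lemma deg {r : ℤ} (hr : 2 ≤ r) : A.Deg r := by
  have key : ∀ N : ℕ, ∀ r : ℤ, 2 ≤ r → r < 2 + N → A.Deg r := by
    intro N
    induction N with
    | zero => intro r h h'; simp at h'; omega
    | succ N ih =>
      intro r h h'
      push_cast at h'
      exact H.deg_step h fun s hs hs' => ih s hs (by omega)
  exact key (r - 1).toNat r hr (by omega)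

end FiltCx.IsPure

/-- Degeneration at the second page, in terms of elements. -/
lemma FiltCx.exists_d_eq (hD : ∀ r, 2 ≤ r → A.Deg r) (hij : i + 1 = j) (hmn : m < n)
    {x : A.cx.obj.X i} (hx : x ∈ A.W n i) (hdx : (A.cx.obj.d i j).hom x ∈ A.W m j) :
    ∃ z ∈ A.W (m + 1) i, (A.cx.obj.d i j).hom z = (A.cx.obj.d i j).hom x := by
  obtain ⟨c, -, hc, -⟩ := A.biregular.finite j
  have key : ∀ N : ℕ, ∃ z ∈ A.W (m + 1) i, (A.cx.obj.d i j).hom (x - z) ∈ A.W (m - N) j := by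
    intro N
    induction N with
    | zero => exact ⟨0, zero_mem _, by simpa using hdx⟩
    | succ N ih =>
      obtain ⟨z, hz, hxz⟩ := ih
      rcases (show m - N + 1 ≤ n by omega).eq_or_lt with h | h
      -- This case forces $N=0$ and $n=m+1$: only $d_1$ would be involved, and $z=x$ is already
      -- allowed. Otherwise the page $n-(m-N)$ is at least 2.
      · have hxW : x ∈ A.W (m + 1) i := A.biregular.mono _ _ _ (by omega) hx
        exact ⟨x, hxW, by simp⟩
      · obtain ⟨z', hz', hxz'⟩ := (hD (n - (m - N)) (by omega)).exists (by omega)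
          (add_sub_cancel _ _) hij (sub_mem hx (A.biregular.mono i _ n (by omega) hz)) hxz
        refine ⟨z + z', add_mem hz (A.biregular.mono _ _ _ (by omega) hz'), ?_⟩
        rw [← sub_sub]
        exact A.biregular.mono _ _ _ (by omega) hxz'
  obtain ⟨z, hz, hxz⟩ := key (m - c).toNat
  have := A.biregular.mono j _ c (by omega) hxz
  rw [hc, Submodule.mem_bot, map_sub, sub_eq_zero] at this
  exact ⟨z, hz, this.symm⟩

namespace FiltCx.IsPure

variable (H : A.IsPure F σ)
include H

/-- On cohomology, $F\cap W$ is induced by cocycles in both filtrations at once. The level of $y$ is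
lowered one step at a time: degeneration puts the bounding cochain one step above $y$, and
`strict_two` moves it into $F^p$. -/
lemma exists_cohomologous (hij : i + 1 = j) {y : A.cx.obj.X j} {w : A.cx.obj.X i}
    (hyF : y ∈ F p j) (hyw : y - (A.cx.obj.d i j).hom w ∈ A.W m j) :
    ∃ w', y - (A.cx.obj.d i j).hom w' ∈ A.W m j ∧ y - (A.cx.obj.d i j).hom w' ∈ F p j := by
  obtain ⟨-, b, -, hb⟩ := A.biregular.finite j
  obtain ⟨-, b', -, hb'⟩ := A.biregular.finite i
  have key : ∀ N : ℕ, ∀ y : A.cx.obj.X j, ∀ w : A.cx.obj.X i, y ∈ F p j →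
      y - (A.cx.obj.d i j).hom w ∈ A.W m j → y ∈ A.W (m + N) j →
      ∃ w', y - (A.cx.obj.d i j).hom w' ∈ A.W m j ∧ y - (A.cx.obj.d i j).hom w' ∈ F p j := by
    intro N
    induction N with
    | zero =>
      intro y w hyF _ hy
      exact ⟨0, by simpa using hy, by simpa using hyF⟩
    | succ N ih =>
      intro y w hyF hyw hy
      push_cast at hy
      have hdw : (A.cx.obj.d i j).hom w ∈ A.W (m + (N + 1)) j := by
        have := sub_mem hy (A.biregular.mono j _ (m + (N + 1)) (by omega) hyw)
        rwa [sub_sub_cancel] at this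
      obtain ⟨z, hz, hdz⟩ := FiltCx.exists_d_eq (fun r hr => H.deg hr) hij
        (n := max b' (m + (N + 1) + 1)) (by omega)
        (A.biregular.mono _ b' _ (by omega) (by rw [hb']; trivial)) hdw
      obtain ⟨t, htF, ht, hyt⟩ := H.strict_two hij hyF hy hz
        (by rw [hdz]; exact A.biregular.mono _ _ _ (by omega) hyw)
      obtain ⟨w', hw', hwF'⟩ := ih (y - (A.cx.obj.d i j).hom t) (w - t)
        (sub_mem hyF (H.biregular.map_d p i j htF)) (by rwa [map_sub, sub_sub_sub_cancel_right])
        (A.biregular.mono _ _ _ (by omega) hyt)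
      refine ⟨t + w', ?_, ?_⟩
      · rwa [map_add, ← sub_sub]
      · rwa [map_add, ← sub_sub]
  exact key (b - m).toNat y w hyF hyw (A.biregular.mono _ b _ (by omega) (by rw [hb]; trivial))

end FiltCx.IsPure

lemma FiltCx.RRel.dRel {h : Coh A.cx.obj i} {e : Coh (A.grCx n) i} (H : A.RRel n i h e) :
    A.DRel n (n - 1) i (i + 1) e 0 := by
  obtain ⟨x, hx, -, hxe⟩ := H
  exact ⟨x, hxe, by rw [hx]; exact FiltCx.isCls_zero (zero_mem _)⟩

lemma FiltCx.RRel.wCoh {h : Coh A.cx.obj i} {e : Coh (A.grCx n) i} (H : A.RRel n i h e) :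
    A.WCoh n i h := by
  obtain ⟨x, hx, rfl, hxe⟩ := H
  exact ⟨x, hx, hxe.mem, rfl⟩

lemma FiltCx.WCoh.exists_rRel {h : Coh A.cx.obj i} (H : A.WCoh n i h) : ∃ e, A.RRel n i h e := by
  obtain ⟨x, hx, hxW, rfl⟩ := H
  obtain ⟨e, he⟩ := FiltCx.exists_isCls rfl hxW (by rw [hx]; exact zero_mem _)
  exact ⟨e, x, hx, rfl, he⟩

/-- With `rRel_zero_left_iff`, this makes `RRel` serve as the isomorphism between
$\mathrm{gr}^W_nH^i$ and $\ker d_1/\operatorname{im}d_1$. -/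
lemma FiltCx.rRel_zero_right_iff {h : Coh A.cx.obj i} : A.RRel n i h 0 ↔ A.WCoh (n - 1) i h := by
  constructor
  · rintro ⟨x, hx, rfl, hxe⟩
    obtain ⟨z, hz, hxz⟩ := (FiltCx.isCls_zero_iff (h := i - 1) (by omega)).1 hxe
    exact ⟨_, by rw [map_sub, hx, d_d, sub_zero], hxz,
      (Coh.mk_eq _ _ _ _ _ _).2 ⟨z, by abel⟩⟩
  · rintro ⟨x, hx, hxW, rfl⟩
    exact ⟨x, hx, rfl, FiltCx.isCls_zero hxW⟩

/-- A coboundary in $W_n$ is, by degeneration, the differential of an element of $W_{n+1}$; so the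
only classes killed on the way to the abutment are the values of $d_1$. -/
lemma FiltCx.rRel_zero_left_iff (hD : ∀ r, 2 ≤ r → A.Deg r) (hij : i + 1 = j)
    {e : Coh (A.grCx n) j} : A.RRel n j 0 e ↔ ∃ e', A.DRel (n + 1) n i j e' e := by
  obtain rfl : i = j - 1 := by omega
  constructor
  · rintro ⟨x, hx, h0, hxe⟩
    obtain ⟨z, rfl⟩ := (Coh.mk_eq_zero _ _ _ _).1 h0.symm
    obtain ⟨-, b, -, hb⟩ := A.biregular.finite (j - 1)
    obtain ⟨z', hz', hdz'⟩ := FiltCx.exists_d_eq hD hij (n := max b (n + 1)) (by omega)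
      (A.biregular.mono _ b _ (by omega) (by rw [hb]; trivial)) hxe.mem
    rw [← hdz'] at hxe
    obtain ⟨e', he'⟩ := FiltCx.exists_isCls (n := n + 1) hij hz'
      (A.biregular.mono _ _ _ (by omega) hxe.mem)
    exact ⟨e', z', he', hxe⟩
  · rintro ⟨e', z, hz, hdz⟩
    exact ⟨_, d_d _ _ _ _ _, ((Coh.mk_eq_zero _ _ _ _).2 ⟨z, rfl⟩).symm, hdz⟩

/-! ### Opposed filtrations on $\mathrm{gr}^W$ of the cohomology. -/

namespace FiltCx.IsPure

variable (H : A.IsPure F σ)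
include H

lemma exists_rRel_of_fCls {e : Coh (A.grCx n) i} (heF : A.FCls F n p i e)
    (he : A.DRel n (n - 1) i (i + 1) e 0) : ∃ h, A.FCoh F p i h ∧ A.RRel n i h e := by
  obtain ⟨c, -, hc, -⟩ := A.biregular.finite (i + 1)
  -- With $r\ge n-c$, $dx$ falls into $W_c=0$ and the representative is a true cocycle in $F^p$.
  obtain ⟨x, hxF, hx, hdx⟩ := H.exists_rep (r := max 2 (n - c)) (by omega)
    (fun s hs _ => H.deg hs) rfl heF he
  have := A.biregular.mono (i + 1) _ c (by omega) hdx
  rw [hc, Submodule.mem_bot] at this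
  exact ⟨_, ⟨x, this, hxF, rfl⟩, x, this, rfl, hx⟩

lemma exists_fCls_of_fCoh {h : Coh A.cx.obj i} (hF : A.FCoh F p i h) (hW : A.WCoh n i h) :
    ∃ e, A.FCls F n p i e ∧ A.RRel n i h e := by
  obtain ⟨y, hy, hyF, rfl⟩ := hF
  obtain ⟨x, hx, hxW, hyx⟩ := hW
  obtain ⟨w, hw⟩ := (Coh.mk_eq _ _ _ _ _ _).1 hyx
  obtain ⟨w', hw', hwF'⟩ := H.exists_cohomologous (i := i - 1) (j := i) (m := n) (w := w)
    (by omega) hyF (by rw [hw, sub_sub_cancel]; exact hxW)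
  have hd : (A.cx.obj.d i (i + 1)).hom (y - (A.cx.obj.d (i - 1) i).hom w') = 0 := by
    rw [map_sub, d_d, hy, sub_zero]
  obtain ⟨e, he⟩ := FiltCx.exists_isCls rfl hw' (by rw [hd]; exact zero_mem _)
  exact ⟨e, ⟨_, hwF', he⟩, _, hd, (Coh.mk_eq _ _ _ _ _ _).2 ⟨w', by abel⟩, he⟩

variable {τ : Coh A.cx.obj i →+ Coh A.cx.obj i} (hτ : ∀ h, τ (τ h) = h)
  (hR : ∀ n h e, A.RRel n i h e → A.RRel n i (τ h) (σ n i e))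

omit H in
include hR in
lemma wCoh_conj {h : Coh A.cx.obj i} (hW : A.WCoh n i h) : A.WCoh n i (τ h) := by
  obtain ⟨e, he⟩ := hW.exists_rRel
  exact (hR n h e he).wCoh

include hτ hR in
/-- The filtrations induced by `F` and its conjugate span `gr^W_n H^i(A)`. -/
lemma coh_split (hab : a + b = n + i + 1) {h : Coh A.cx.obj i} (hW : A.WCoh n i h) :
    ∃ h₁ h₂, A.FCoh F a i h₁ ∧ A.WCoh n i h₁ ∧ A.FCoh F b i (τ h₂) ∧ A.WCoh n i h₂ ∧
      A.WCoh (n - 1) i (h - h₁ - h₂) := by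
  obtain ⟨e, he⟩ := hW.exists_rRel
  obtain ⟨f, g, rfl, hf, hg⟩ := H.split hab e
  -- Both components survive, since each is itself in $\ker d_1$; each then lifts to $H^i$ within
  -- its own filtration, $g$ after conjugation.
  obtain ⟨hf0, hg0⟩ := H.split_ker rfl (by omega) hab he.dRel hf hg
  have hg0' := H.dRel rfl (by omega) hg0
  rw [map_zero] at hg0'
  obtain ⟨h₁, hF₁, hR₁⟩ := H.exists_rRel_of_fCls hf hf0
  obtain ⟨h₂, hF₂, hR₂⟩ := H.exists_rRel_of_fCls hg hg0'
  have hR₂' := hR _ _ _ hR₂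
  rw [H.invol] at hR₂'
  refine ⟨h₁, τ h₂, hF₁, hR₁.wCoh, by rwa [hτ], hR₂'.wCoh, FiltCx.rRel_zero_right_iff.1 ?_⟩
  have := (he.sub hR₁).sub hR₂'
  rwa [add_sub_cancel_left, sub_self] at this

include hτ hR in
/-- The filtrations induced by `F` and its conjugate are disjoint on `gr^W_n H^i(A)`. -/
lemma coh_disjoint (hab : a + b = n + i + 1) {h₁ h₂ : Coh A.cx.obj i} (hF₁ : A.FCoh F a i h₁)
    (hW₁ : A.WCoh n i h₁) (hF₂ : A.FCoh F b i (τ h₂)) (hW₂ : A.WCoh n i h₂)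
    (h : A.WCoh (n - 1) i (h₁ - h₂)) : A.WCoh (n - 1) i h₁ := by
  obtain ⟨e₁, he₁, hR₁⟩ := H.exists_fCls_of_fCoh hF₁ hW₁
  obtain ⟨e₂, he₂, hR₂⟩ := H.exists_fCls_of_fCoh hF₂ (wCoh_conj hR hW₂)
  have hR₂' := hR _ _ _ hR₂
  rw [hτ] at hR₂'
  have h0 := (hR₁.sub hR₂').sub (FiltCx.rRel_zero_right_iff.2 h)
  rw [sub_self, sub_zero] at h0
  have hD : ∀ r, 2 ≤ r → A.Deg r := fun r hr => H.deg hr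
  -- The hypothesis on $h_1-h_2$ says that $e_1$ and $\sigma e_2$ agree on $E_2$. Disjointness there
  -- puts $e_1$ in the image of $d_1$, so $h_1$ vanishes in $\mathrm{gr}^W_n$.
  obtain ⟨e, he⟩ := (FiltCx.rRel_zero_left_iff hD (i := i - 1) (by omega)).1 h0
  have h1 := H.mem_range_of_sub_mem_range (by omega) hab.ge he he₁ (by rwa [H.invol])
  have h2 := hR₁.sub ((FiltCx.rRel_zero_left_iff hD (i := i - 1) (by omega)).2 h1)
  rw [sub_self, sub_zero] at h2
  exact FiltCx.rRel_zero_right_iff.1 h2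

end FiltCx.IsPure

end Core

/-! ### Subspaces and graded pieces after extension of scalars. -/

section BaseChange

variable {V : Type*} [AddCommGroup V] [Module ℚ V]

/-- The class of $v$ in $V/U$ becomes zero in $\mathbb C\otimes V/U$, and $V/U$ embeds there by
faithful flatness. -/
lemma mem_of_tmul_mem_baseChange {U : Submodule ℚ V} {v : V}
    (h : (1 : ℂ) ⊗ₜ[ℚ] v ∈ U.baseChange ℂ) : v ∈ U := by
  have h1 := range_baseChange_complex U.subtype
  rw [Submodule.range_subtype] at h1
  rw [h1] at h
  obtain ⟨y, hy⟩ := h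
  have h2 : (U.mkQ).baseChange ℂ ((1 : ℂ) ⊗ₜ[ℚ] v) = 0 := by
    rw [← hy, ← LinearMap.comp_apply, ← LinearMap.baseChange_comp]
    have : U.mkQ ∘ₗ U.subtype = 0 := by ext x; simp
    rw [this]
    simp
  rw [LinearMap.baseChange_tmul] at h2
  have h3 : Function.Injective (fun m : V ⧸ U => (1 : ℂ) ⊗ₜ[ℚ] m) :=
    Module.Flat.tensorProduct_mk_injective (R := ℚ) (S := ℂ) (V ⧸ U)
  have h4 : U.mkQ v = 0 := h3 (by simpa using h2)
  exact (Submodule.Quotient.mk_eq_zero U).1 h4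

lemma exists_of_mem_baseChange {U : Submodule ℚ V} {t : ℂ ⊗[ℚ] V} (h : t ∈ U.baseChange ℂ) :
    ∃ s, U.subtype.baseChange ℂ s = t := by
  obtain ⟨s, hs⟩ := U.toBaseChange_surjective ℂ ⟨t, h⟩
  exact ⟨s, congrArg Subtype.val hs⟩

lemma subtype_baseChange_mem {U : Submodule ℚ V} (s : ℂ ⊗[ℚ] U) :
    U.subtype.baseChange ℂ s ∈ U.baseChange ℂ :=
  (U.toBaseChange ℂ s).2

lemma mkQ_baseChange_eq_zero_iff {U U' : Submodule ℚ V} (hU : U' ≤ U) (s : ℂ ⊗[ℚ] U) :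
    (Submodule.mkQ (U'.comap U.subtype)).baseChange ℂ s = 0 ↔
      U.subtype.baseChange ℂ s ∈ U'.baseChange ℂ := by
  rw [← LinearMap.mem_ker, ← ker_baseChange_complex, Submodule.ker_mkQ]
  constructor
  · intro h
    obtain ⟨y, rfl⟩ := exists_of_mem_baseChange h
    rw [← LinearMap.comp_apply, ← LinearMap.baseChange_comp]
    clear h
    induction y with
    | zero => rw [map_zero]; exact zero_mem _
    | add x y hx hy => rw [map_add]; exact add_mem hx hy
    | tmul c y => exact Submodule.tmul_mem_baseChange_of_mem c y.2
  · intro h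
    obtain ⟨y, hy⟩ := exists_of_mem_baseChange h
    have hj : U.subtype.baseChange ℂ ((Submodule.inclusion hU).baseChange ℂ y) =
        U.subtype.baseChange ℂ s := by
      rw [← hy, ← LinearMap.comp_apply, ← LinearMap.baseChange_comp]
      rfl
    have hinj : Function.Injective (U.subtype.baseChange ℂ) :=
      Module.Flat.lTensor_preserves_injective_linearMap (M := ℂ) U.subtype U.injective_subtype
    rw [← hinj hj]
    clear hj h hy
    induction y with
    | zero => rw [map_zero]; exact zero_mem _
    | add x y hx hy => rw [map_add]; exact add_mem hx hy
    | tmul c y => exact Submodule.tmul_mem_baseChange_of_mem c y.2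

variable {W : ℤ → Submodule ℚ V} {F : ℤ → Submodule ℂ (ℂ ⊗[ℚ] V)} {n : ℤ}

lemma inducedGr_antitone (hF : Antitone F) : Antitone (inducedGr W F n) :=
  fun _ _ h => Submodule.map_mono (Submodule.comap_mono (hF h))

lemma inducedGr_eq_top {a : ℤ} (ha : F a = ⊤) : inducedGr W F n a = ⊤ := by
  rw [inducedGr, ha, Submodule.comap_top, Submodule.map_top, LinearMap.range_eq_top]
  exact LinearMap.baseChange_surjective _ (Submodule.mkQ_surjective _)

lemma inducedGr_eq_bot {b : ℤ} (hb : F b = ⊥) : inducedGr W F n b = ⊥ := by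
  have hinj : Function.Injective ((W n).subtype.baseChange ℂ) :=
    Module.Flat.lTensor_preserves_injective_linearMap (M := ℂ) (W n).subtype
      (W n).injective_subtype
  rw [inducedGr, hb, Submodule.comap_bot, LinearMap.ker_eq_bot.2 hinj, Submodule.map_bot]

/-- Complementarity of the filtrations induced on `gr^W_n` by `F` and its conjugate, in terms of
elements of `ℂ ⊗ V`. -/
lemma inducedGr_isCompl (hW : W (n - 1) ≤ W n) {a b : ℤ}
    (hs : ∀ t ∈ (W n).baseChange ℂ, ∃ t₁ ∈ F a, ∃ t₂ ∈ conjFiltration F b,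
      t₁ ∈ (W n).baseChange ℂ ∧ t₂ ∈ (W n).baseChange ℂ ∧ t - t₁ - t₂ ∈ (W (n - 1)).baseChange ℂ)
    (hd : ∀ t₁ ∈ F a, ∀ t₂ ∈ conjFiltration F b, t₁ ∈ (W n).baseChange ℂ →
      t₂ ∈ (W n).baseChange ℂ → t₁ - t₂ ∈ (W (n - 1)).baseChange ℂ →
      t₁ ∈ (W (n - 1)).baseChange ℂ) :
    IsCompl (inducedGr W F n a) (conjFiltration (inducedGr W F n) b) := by
  refine ⟨Submodule.disjoint_def.2 ?_, codisjoint_iff.2 (Submodule.eq_top_iff'.2 ?_)⟩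
  · rintro _ ⟨s₁, hs₁, rfl⟩ ⟨s₂, hs₂, hs⟩
    rw [mkQ_baseChange_eq_zero_iff hW]
    have h2 := congrArg (conjugation _) hs
    rw [conjugation_conjugation, conjugation_baseChange] at h2
    -- The second representative $s_2$ lifts the conjugate class, so its conjugate is the one to
    -- compare with $s_1$.
    refine hd _ hs₁ ((W n).subtype.baseChange ℂ (conjugation _ s₂)) ?_
      (subtype_baseChange_mem _) (subtype_baseChange_mem _) ?_
    · rw [conjFiltration, Submodule.mem_comap, conjugation_baseChange, conjugation_conjugation]
      exact hs₂
    · rw [← map_sub, ← mkQ_baseChange_eq_zero_iff hW, map_sub, h2, sub_self]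
  · intro y
    obtain ⟨s, rfl⟩ := LinearMap.baseChange_surjective ℂ
      (Submodule.mkQ_surjective ((W (n - 1)).comap (W n).subtype)) y
    obtain ⟨t₁, ht₁, t₂, ht₂, hW₁, hW₂, h⟩ := hs _ (subtype_baseChange_mem s)
    obtain ⟨s₁, rfl⟩ := exists_of_mem_baseChange hW₁
    obtain ⟨s₂, rfl⟩ := exists_of_mem_baseChange hW₂
    rw [← map_sub, ← map_sub, ← mkQ_baseChange_eq_zero_iff hW, map_sub, map_sub, sub_sub,
      sub_eq_zero] at h
    rw [h]
    refine Submodule.add_mem_sup ⟨s₁, ht₁, rfl⟩ ⟨conjugation _ s₂, ?_, ?_⟩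
    · change (W n).subtype.baseChange ℂ (conjugation _ s₂) ∈ F b
      rw [← conjugation_baseChange]
      exact ht₂
    · rw [conjugation_baseChange]

end BaseChange

/-! ### Conjugation on $\mathbb C\otimes K$ and descent of degeneration to $\mathbb Q$. -/

section Complexify

variable (K : FiltCx.{u} ℚ)

/-- The natural map `ℂ ⊗ H^i(gr^W_n K) → H^i(gr^W_n (ℂ ⊗ K))`. -/
def grCohComplexMap (n i : ℤ) :
    ℂ ⊗[ℚ] Coh (K.grCx n) i →ₗ[ℂ] Coh (K.complexify.grCx n) i :=
  Coh.map (grComplexIso K n).hom.hom i ∘ₗ (cohComplexEquiv (K.grCx n) i).toLinearMap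

variable {K} {n m i j : ℤ}

lemma Coh.mk_add {k : Type} [Field k] (L : CochainComplex (ModuleCat.{u} k) ℤ) (x y : L.X i)
    (hx : (L.d i (i + 1)).hom x = 0) (hy : (L.d i (i + 1)).hom y = 0) :
    Coh.mk L i x hx + Coh.mk L i y hy = Coh.mk L i (x + y) (by rw [map_add, hx, hy, add_zero]) :=
  rfl

lemma Coh.mk_congr {k : Type} [Field k] {L : CochainComplex (ModuleCat.{u} k) ℤ} {x y : L.X i}
    (h : x = y) (hx : (L.d i (i + 1)).hom x = 0) :
    Coh.mk L i x hx = Coh.mk L i y (h ▸ hx) := by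
  subst h
  rfl

lemma cohComplexEquiv_tmul (L : CochainComplex (ModuleCat.{u} ℚ) ℤ) (c : ℂ) (x : L.X i)
    (hx : (L.d i (i + 1)).hom x = 0) :
    cohComplexEquiv L i (c ⊗ₜ Coh.mk L i x hx) = Coh.mk (complexify L) i (c ⊗ₜ[ℚ] x)
      (by
        change (L.d i (i + 1)).hom.baseChange ℂ (c ⊗ₜ[ℚ] x) = 0
        rw [LinearMap.baseChange_tmul, hx, TensorProduct.tmul_zero]) := by
  refine (Subq.complexMap_tmul (cocycles L i) (coboundaries L i) _ _
    (ker_baseChange_complex _).le (range_baseChange_complex _).le c ⟨x, hx⟩).trans ?_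
  rw [← Submodule.Quotient.mk_smul]
  refine congrArg (Submodule.Quotient.mk (p := (coboundaries (complexify L) i).comap
    (cocycles (complexify L) i).subtype)) (Subtype.ext ?_)
  change c • ((1 : ℂ) ⊗ₜ[ℚ] x) = c ⊗ₜ[ℚ] x
  rw [TensorProduct.smul_tmul', smul_eq_mul, mul_one]

/-- Complex conjugation on the terms of `ℂ ⊗ K`. -/
def FiltCx.conj (K : FiltCx.{u} ℚ) (i : ℤ) (x : K.complexify.cx.obj.X i) :
    K.complexify.cx.obj.X i :=
  conjugation (K.cx.obj.X i) x

lemma FiltCx.conj_add (x y : K.complexify.cx.obj.X i) :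
    K.conj i (x + y) = K.conj i x + K.conj i y :=
  map_add (conjugation (K.cx.obj.X i)) x y

lemma FiltCx.conj_sub (x y : K.complexify.cx.obj.X i) :
    K.conj i (x - y) = K.conj i x - K.conj i y :=
  map_sub (conjugation (K.cx.obj.X i)) x y

lemma FiltCx.d_conj (x : K.complexify.cx.obj.X i) :
    (K.complexify.cx.obj.d i j).hom (K.conj i x) =
      K.conj j ((K.complexify.cx.obj.d i j).hom x) :=
  (conjugation_baseChange (K.cx.obj.d i j).hom x).symm

lemma FiltCx.conj_mem {x : K.complexify.cx.obj.X i} (hx : x ∈ K.complexify.W n i) :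
    K.conj i x ∈ K.complexify.W n i :=
  conjugation_mem_baseChange (W := K.W n i) hx

lemma exists_isCls_conj (t : ℂ ⊗[ℚ] Coh (K.grCx n) i) :
    ∃ x, K.complexify.IsCls n i x (grCohComplexMap K n i t) ∧
      K.complexify.IsCls n i (K.conj i x) (grCohComplexMap K n i (conjugation _ t)) := by
  induction t with
  | zero =>
    refine ⟨0, ?_, ?_⟩
    · rw [map_zero]
      exact FiltCx.isCls_zero (zero_mem _)
    · rw [map_zero, map_zero]
      exact FiltCx.isCls_zero (FiltCx.conj_mem (zero_mem _))
  | add s t hs ht =>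
    obtain ⟨x, hx, hx'⟩ := hs
    obtain ⟨y, hy, hy'⟩ := ht
    refine ⟨x + y, ?_, ?_⟩
    · rw [map_add]
      exact hx.add hy
    · rw [map_add, map_add, FiltCx.conj_add]
      exact hx'.add hy'
  | tmul c e =>
    obtain ⟨x, hx, hdx, rfl⟩ := K.isCls_surj n i e
    have key (c : ℂ) : K.complexify.IsCls n i (c ⊗ₜ[ℚ] x)
        (grCohComplexMap K n i (c ⊗ₜ K.grCls n i x hx hdx)) := by
      have h1 : (c ⊗ₜ[ℚ] x : ℂ ⊗[ℚ] K.cx.obj.X i) ∈ (K.W n i).baseChange ℂ :=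
        Submodule.tmul_mem_baseChange_of_mem c hx
      refine ⟨h1, ?_, ?_⟩
      · change (K.cx.obj.d i (i + 1)).hom.baseChange ℂ (c ⊗ₜ[ℚ] x) ∈
          (K.W (n - 1) (i + 1)).baseChange ℂ
        rw [LinearMap.baseChange_tmul]
        exact Submodule.tmul_mem_baseChange_of_mem c hdx
      · refine (congrArg (Coh.map (grComplexIso K n).hom.hom i)
          (cohComplexEquiv_tmul (K.grCx n) c (K.grMk n i x hx) _)).trans ?_
        refine congrArg (Submodule.Quotient.mk (p := (coboundaries (K.complexify.grCx n) i).comap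
          (cocycles (K.complexify.grCx n) i).subtype)) (Subtype.ext ?_)
        refine (grComplexEquiv_tmul K n i c ⟨x, hx⟩).trans ?_
        rw [← Submodule.Quotient.mk_smul]
        refine congrArg (Submodule.Quotient.mk (p := (K.complexify.W (n - 1) i).comap
          (K.complexify.W n i).subtype)) (Subtype.ext ?_)
        change c • ((1 : ℂ) ⊗ₜ[ℚ] x) = c ⊗ₜ[ℚ] x
        rw [TensorProduct.smul_tmul', smul_eq_mul, mul_one]
    refine ⟨c ⊗ₜ[ℚ] x, key c, ?_⟩
    rw [conjugation_tmul]
    exact key _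

/-- Conjugation commutes with $d$ and preserves $\mathbb C\otimes W$, so it sends zero classes to
zero classes. It is therefore enough to know the result for one representative, built from pure
tensors. -/
lemma isCls_conj {t : ℂ ⊗[ℚ] Coh (K.grCx n) i} {x : K.complexify.cx.obj.X i}
    (h : K.complexify.IsCls n i x (grCohComplexMap K n i t)) :
    K.complexify.IsCls n i (K.conj i x) (grCohComplexMap K n i (conjugation _ t)) := by
  obtain ⟨y, hy, hy'⟩ := exists_isCls_conj t
  have h0 := h.sub hy
  rw [sub_self] at h0
  obtain ⟨z, hz, hxz⟩ := (FiltCx.isCls_zero_iff (h := i - 1) (by omega)).1 h0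
  have h1 : K.complexify.IsCls n i (K.conj i (x - y)) 0 := by
    refine (FiltCx.isCls_zero_iff (h := i - 1) (by omega)).2
      ⟨K.conj _ z, FiltCx.conj_mem hz, ?_⟩
    rw [FiltCx.d_conj, ← FiltCx.conj_sub]
    exact FiltCx.conj_mem hxz
  have := hy'.add h1
  rwa [← FiltCx.conj_add, add_sub_cancel, add_zero] at this

lemma dRel_conj {t : ℂ ⊗[ℚ] Coh (K.grCx n) i} {s : ℂ ⊗[ℚ] Coh (K.grCx m) j}
    (h : K.complexify.DRel n m i j (grCohComplexMap K n i t) (grCohComplexMap K m j s)) :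
    K.complexify.DRel n m i j (grCohComplexMap K n i (conjugation _ t))
      (grCohComplexMap K m j (conjugation _ s)) := by
  obtain ⟨x, hx, hdx⟩ := h
  refine ⟨_, isCls_conj hx, ?_⟩
  rw [FiltCx.d_conj]
  exact isCls_conj hdx

lemma exists_mk_conj (t : ℂ ⊗[ℚ] Coh K.cx.obj i) :
    ∃ x hx hx', cohComplexEquiv K.cx.obj i t = Coh.mk K.complexify.cx.obj i x hx ∧
      cohComplexEquiv K.cx.obj i (conjugation _ t) =
        Coh.mk K.complexify.cx.obj i (K.conj i x) hx' := by
  induction t with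
  | zero =>
    refine ⟨0, map_zero _, ?_, ?_, ?_⟩
    · rw [FiltCx.d_conj, map_zero]
      exact map_zero (conjugation (K.cx.obj.X (i + 1)))
    · rw [map_zero]
      rfl
    · rw [map_zero, map_zero]
      refine ((Coh.mk_eq_zero _ _ _ _).2 ⟨0, ?_⟩).symm
      rw [map_zero]
      exact (map_zero (conjugation (K.cx.obj.X i))).symm
  | add s t hs ht =>
    obtain ⟨x, hx, hx', h, h'⟩ := hs
    obtain ⟨y, hy, hy', g, g'⟩ := ht
    refine ⟨x + y, by rw [map_add, hx, hy, add_zero],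
      by rw [FiltCx.conj_add, map_add, hx', hy', add_zero], ?_, ?_⟩
    · rw [map_add, h, g]
      rfl
    · rw [map_add, map_add, h', g']
      exact (Coh.mk_add K.complexify.cx.obj _ _ hx' hy').trans
        (Coh.mk_congr (FiltCx.conj_add x y).symm _)
  | tmul c e =>
    obtain ⟨x, hx, rfl⟩ := Coh.mk_surj _ _ e
    refine ⟨c ⊗ₜ[ℚ] x, ?_, ?_, cohComplexEquiv_tmul _ c x hx, ?_⟩
    · change (K.cx.obj.d i (i + 1)).hom.baseChange ℂ (c ⊗ₜ[ℚ] x) = 0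
      rw [LinearMap.baseChange_tmul, hx, TensorProduct.tmul_zero]
    · change (K.cx.obj.d i (i + 1)).hom.baseChange ℂ (starRingEnd ℂ c ⊗ₜ[ℚ] x) = 0
      rw [LinearMap.baseChange_tmul, hx, TensorProduct.tmul_zero]
    · rw [conjugation_tmul]
      exact cohComplexEquiv_tmul _ _ x hx

lemma rRel_conj {h : ℂ ⊗[ℚ] Coh K.cx.obj i} {t : ℂ ⊗[ℚ] Coh (K.grCx n) i}
    (H : K.complexify.RRel n i (cohComplexEquiv K.cx.obj i h) (grCohComplexMap K n i t)) :
    K.complexify.RRel n i (cohComplexEquiv K.cx.obj i (conjugation _ h))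
      (grCohComplexMap K n i (conjugation _ t)) := by
  obtain ⟨x, hx, hxh, hxt⟩ := H
  obtain ⟨y, hy, hy', h1, h2⟩ := exists_mk_conj h
  obtain ⟨z, hz⟩ := (Coh.mk_eq _ _ _ _ _ _).1 (hxh.symm.trans h1)
  refine ⟨K.conj i x, ?_, ?_, isCls_conj hxt⟩
  · rw [FiltCx.d_conj, hx]
    exact map_zero (conjugation (K.cx.obj.X (i + 1)))
  · rw [h2]
    refine (Coh.mk_eq _ _ _ _ _ _).2 ⟨K.conj _ (-z), ?_⟩
    rw [FiltCx.d_conj, map_neg, hz, neg_sub, FiltCx.conj_sub]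

/-- The filtration `ℂ ⊗ Dec(W)` on `ℂ ⊗ H^i(K)` is induced by the filtration of `ℂ ⊗ K`. -/
lemma wCoh_complexify_iff (t : ℂ ⊗[ℚ] Coh K.cx.obj i) :
    K.complexify.WCoh (n - i) i (cohComplexEquiv K.cx.obj i t) ↔
      t ∈ (K.decCoh i n).baseChange ℂ := by
  -- The cocycles of $K^i$ in $W_{n-i}$ form the kernel of $g$, and $\mathrm{Dec}(W)_nH^i$ is the
  -- image of this kernel. Kernels and images both commute with $\mathbb C\otimes -$, which yields
  -- the equivalence.
  let g : K.W (n - i) i →ₗ[ℚ] K.cx.obj.X (i + 1) :=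
    (K.cx.obj.d i (i + 1)).hom ∘ₗ (K.W (n - i) i).subtype
  let ι : LinearMap.ker g →ₗ[ℚ] K.cx.obj.X i :=
    (K.W (n - i) i).subtype ∘ₗ (LinearMap.ker g).subtype
  let π : LinearMap.ker g →ₗ[ℚ] Coh K.cx.obj i :=
    Submodule.mkQ _ ∘ₗ ι.codRestrict (cocycles K.cx.obj i) (fun x => x.2)
  have hπ : LinearMap.range π = K.decCoh i n := by
    apply le_antisymm
    · rintro _ ⟨x, rfl⟩
      exact ⟨⟨x, x.2⟩, x.1.2, rfl⟩
    · rintro _ ⟨x, hx, rfl⟩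
      exact ⟨⟨⟨x, hx⟩, x.2⟩, rfl⟩
  have hι (y : ℂ ⊗[ℚ] LinearMap.ker g) : (K.complexify.cx.obj.d i (i + 1)).hom
      (ι.baseChange ℂ y) = 0 := by
    change (K.cx.obj.d i (i + 1)).hom.baseChange ℂ (ι.baseChange ℂ y) = 0
    rw [← LinearMap.comp_apply, ← LinearMap.baseChange_comp]
    have : (K.cx.obj.d i (i + 1)).hom ∘ₗ ι = 0 := by
      ext x
      exact x.2
    rw [this]
    simp
  have key (y : ℂ ⊗[ℚ] LinearMap.ker g) : cohComplexEquiv K.cx.obj i (π.baseChange ℂ y) =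
      Coh.mk K.complexify.cx.obj i (ι.baseChange ℂ y) (hι y) := by
    induction y with
    | zero =>
      rw [map_zero, map_zero]
      exact ((Coh.mk_eq_zero _ _ _ _).2
        ⟨0, (map_zero _).trans (map_zero (ι.baseChange ℂ)).symm⟩).symm
    | add x y hx hy =>
      rw [map_add, map_add, hx, hy]
      exact (Coh.mk_add K.complexify.cx.obj _ _ (hι x) (hι y)).trans
        (Coh.mk_congr (map_add (ι.baseChange ℂ) x y).symm _)
    | tmul c y => exact cohComplexEquiv_tmul K.cx.obj c (ι y) y.2
  rw [← hπ, range_baseChange_complex]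
  constructor
  · rintro ⟨x, hx, hxW, hxt⟩
    obtain ⟨s, rfl⟩ := exists_of_mem_baseChange hxW
    have hs : s ∈ LinearMap.ker (g.baseChange ℂ) := by
      rw [LinearMap.mem_ker, LinearMap.baseChange_comp]
      exact hx
    rw [← ker_baseChange_complex] at hs
    obtain ⟨y, rfl⟩ := exists_of_mem_baseChange hs
    refine ⟨y, (cohComplexEquiv K.cx.obj i).injective ((key y).trans (Eq.trans ?_ hxt.symm))⟩
    refine (Coh.mk_eq _ _ _ _ _ _).2 ⟨0, ?_⟩
    rw [map_zero, LinearMap.baseChange_comp]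
    exact (sub_self _).symm
  · rintro ⟨y, rfl⟩
    refine ⟨_, hι y, ?_, key y⟩
    rw [LinearMap.baseChange_comp]
    exact subtype_baseChange_mem (U := K.W (n - i) i) _

/-- Degeneration descends from `ℂ ⊗ K` to `K`. -/
lemma exists_d_eq_of_complexify (hD : ∀ r, 2 ≤ r → K.complexify.Deg r) (hij : i + 1 = j)
    (hmn : m < n) {x : K.cx.obj.X i} (hx : x ∈ K.W n i) (hdx : (K.cx.obj.d i j).hom x ∈ K.W m j) :
    ∃ z ∈ K.W (m + 1) i, (K.cx.obj.d i j).hom z = (K.cx.obj.d i j).hom x := by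
  have hd : (K.complexify.cx.obj.d i j).hom ((1 : ℂ) ⊗ₜ[ℚ] x) =
      (1 : ℂ) ⊗ₜ[ℚ] (K.cx.obj.d i j).hom x := LinearMap.baseChange_tmul _ _ _
  have h1 : ((1 : ℂ) ⊗ₜ[ℚ] x : ℂ ⊗[ℚ] K.cx.obj.X i) ∈ (K.W n i).baseChange ℂ :=
    Submodule.tmul_mem_baseChange_of_mem 1 hx
  have h2 : ((1 : ℂ) ⊗ₜ[ℚ] (K.cx.obj.d i j).hom x : ℂ ⊗[ℚ] K.cx.obj.X j) ∈
      (K.W m j).baseChange ℂ := Submodule.tmul_mem_baseChange_of_mem 1 hdx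
  obtain ⟨z, hz, hdz⟩ := FiltCx.exists_d_eq hD hij hmn (x := (1 : ℂ) ⊗ₜ[ℚ] x) h1
    (by rw [hd]; exact h2)
  obtain ⟨s, rfl⟩ := exists_of_mem_baseChange hz
  rw [hd] at hdz
  -- The element $z$ is complex and need not be rational. Only the fact that $1\otimes dx$ lies in
  -- $\mathbb C\otimes d(W_{m+1})$ is kept, and that condition descends.
  have h3 : (1 : ℂ) ⊗ₜ[ℚ] (K.cx.obj.d i j).hom x ∈ (LinearMap.range
      ((K.cx.obj.d i j).hom ∘ₗ (K.W (m + 1) i).subtype)).baseChange ℂ := by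
    rw [range_baseChange_complex, LinearMap.baseChange_comp]
    exact ⟨s, hdz⟩
  obtain ⟨z, hz⟩ := mem_of_tmul_mem_baseChange h3
  exact ⟨z, z.2, hz⟩

lemma degeneratesAt_two {k : Type} [Field k] {K : FiltCx.{u} k}
    (h : ∀ {n m i j : ℤ}, i + 1 = j → m < n → ∀ {x : K.cx.obj.X i}, x ∈ K.W n i →
      (K.cx.obj.d i j).hom x ∈ K.W m j →
      ∃ z ∈ K.W (m + 1) i, (K.cx.obj.d i j).hom z = (K.cx.obj.d i j).hom x) :
    K.DegeneratesAt 2 := by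
  intro r p i hr
  ext x
  have hx1 : (x : K.cx.obj.X i) ∈ K.W (-p) i := x.2.1
  have hx2 : (K.cx.obj.d i (i + 1)).hom (x : K.cx.obj.X i) ∈ K.W (-(p + r)) (i + 1) := x.2.2
  refine (Submodule.Quotient.mk_eq_zero
    ((K.B r (p + r) (i + 1)).comap (K.Z r (p + r) (i + 1)).subtype)).2 ?_
  refine Submodule.mem_sup_right ?_
  obtain ⟨z, hz, hdz⟩ := h rfl (by omega) hx1 hx2
  -- Generalizing over $j$ and $p'$ absorbs the index identities $i+1-1=i$ and $p+r-r+1=p+1$, which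
  -- are not definitional. The bound $r\ge 2$ places $z$ in $W_{-(p+1)}$.
  have key : ∀ j p' : ℤ, j = i → p' = p + 1 → (K.cx.obj.d i (i + 1)).hom (x : K.cx.obj.X i) ∈
      (K.Z (r - 1) p' j).map (K.cx.obj.d j (i + 1)).hom := by
    rintro _ _ rfl rfl
    refine ⟨z, ⟨K.biregular.mono _ _ _ (by omega) hz, ?_⟩, hdz⟩
    rw [SetLike.mem_coe, Submodule.mem_comap, hdz]
    exact K.biregular.mono _ _ _ (by omega) hx2
  exact key _ _ (by omega) (by omega)

end Complexify

/-! ### Relations, weights and degeneration under isomorphisms of $D^+F$. -/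

section Comparison

variable {k : Type} [Field k]

lemma DPlus.cohEquiv_trans {K L N : CochainComplex.Plus (ModuleCat.{u} k)}
    (β : DPlus.Q.obj K ≅ DPlus.Q.obj L) (γ : DPlus.Q.obj L ≅ DPlus.Q.obj N) (i : ℤ)
    (h : Coh K.obj i) :
    DPlus.cohEquiv (β ≪≫ γ) i h = DPlus.cohEquiv γ i (DPlus.cohEquiv β i h) :=
  congrArg (fun g => g.hom h) ((DPlus.cohFunctor i).map_comp β.hom γ.hom)

lemma DPlus.cohEquiv_mapIso {K L : CochainComplex.Plus (ModuleCat.{u} k)} (f : K ≅ L) (i : ℤ)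
    (h : Coh K.obj i) : DPlus.cohEquiv (DPlus.Q.mapIso f) i h = Coh.map f.hom.hom i h :=
  congrArg (fun g => g.hom h) (DPlus.cohFunctor_map_Q f.hom i)

lemma DPlusF.grCohMap_inv_hom {X Y : DPlusF.{u} k} (α : X ≅ Y) (n i : ℤ)
    (e : Coh (X.toFiltCx.grCx n) i) :
    DPlusF.grCohMap α.inv n i (DPlusF.grCohMap α.hom n i e) = e := by
  have h := DPlusF.grCohMap_comp α.hom α.inv n i
  rw [α.hom_inv_id, DPlusF.grCohMap_id] at h
  exact (LinearMap.congr_fun h e).symm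

lemma DPlusF.grCohMap_hom_inv {X Y : DPlusF.{u} k} (α : X ≅ Y) (n i : ℤ)
    (e : Coh (Y.toFiltCx.grCx n) i) :
    DPlusF.grCohMap α.hom n i (DPlusF.grCohMap α.inv n i e) = e :=
  DPlusF.grCohMap_inv_hom α.symm n i e

lemma DPlusF.cohMap_inv_hom {X Y : DPlusF.{u} k} (α : X ≅ Y) (i : ℤ)
    (h : Coh X.toFiltCx.cx.obj i) :
    DPlusF.cohMap α.inv i (DPlusF.cohMap α.hom i h) = h := by
  have H := DPlusF.cohMap_comp α.hom α.inv i
  rw [α.hom_inv_id, DPlusF.cohMap_id] at H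
  exact (LinearMap.congr_fun H h).symm

lemma DPlusF.dRel_map_iff {X Y : DPlusF.{u} k} (α : X ≅ Y) {n m i j : ℤ} (hij : i + 1 = j)
    (hmn : m < n) {e : Coh (X.toFiltCx.grCx n) i} {u : Coh (X.toFiltCx.grCx m) j} :
    Y.toFiltCx.DRel n m i j (DPlusF.grCohMap α.hom n i e) (DPlusF.grCohMap α.hom m j u) ↔
      X.toFiltCx.DRel n m i j e u := by
  refine ⟨fun h => ?_, DPlusF.dRel_map α.hom hij hmn⟩
  have := DPlusF.dRel_map α.inv hij hmn h
  rwa [DPlusF.grCohMap_inv_hom, DPlusF.grCohMap_inv_hom] at this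

lemma DPlusF.rRel_map_iff {X Y : DPlusF.{u} k} (α : X ≅ Y) {n i : ℤ}
    {h : Coh X.toFiltCx.cx.obj i} {e : Coh (X.toFiltCx.grCx n) i} :
    Y.toFiltCx.RRel n i (DPlusF.cohMap α.hom i h) (DPlusF.grCohMap α.hom n i e) ↔
      X.toFiltCx.RRel n i h e := by
  refine ⟨fun H => ?_, DPlusF.rRel_map α.hom⟩
  have := DPlusF.rRel_map α.inv H
  rwa [DPlusF.grCohMap_inv_hom, DPlusF.cohMap_inv_hom] at this

/-- Membership in $W_n$ on cohomology means being related by `RRel` to some class, so it is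
transported together with that relation. -/
lemma DPlusF.wCoh_map_iff {X Y : DPlusF.{u} k} (α : X ≅ Y) {n i : ℤ}
    {h : Coh X.toFiltCx.cx.obj i} :
    Y.toFiltCx.WCoh n i (DPlusF.cohMap α.hom i h) ↔ X.toFiltCx.WCoh n i h := by
  constructor
  · intro H
    obtain ⟨e, he⟩ := H.exists_rRel
    rw [← DPlusF.grCohMap_hom_inv α n i e, DPlusF.rRel_map_iff] at he
    exact he.wCoh
  · intro H
    obtain ⟨e, he⟩ := H.exists_rRel
    exact ((DPlusF.rRel_map_iff α).2 he).wCoh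

lemma DPlusF.deg_of_iso {X Y : DPlusF.{u} k} (α : X ≅ Y) {r : ℤ} (hr : 1 ≤ r)
    (h : Y.toFiltCx.Deg r) : X.toFiltCx.Deg r := by
  intro n m i j hmn hij e u he
  obtain ⟨e', he'⟩ := h hmn hij _ _ ((DPlusF.dRel_map_iff α hij (by omega)).2 he)
  rw [← DPlusF.grCohMap_hom_inv α (m + 1) i e', DPlusF.dRel_map_iff α hij (by omega)] at he'
  exact ⟨_, he'⟩

end Comparison

/-! ### Induced Hodge filtrations in terms of representatives. -/

section FiltrationF

variable {k : Type} [Field k] {A : FiltCx.{u} k} {F : ℤ → ∀ i : ℤ, Submodule k (A.cx.obj.X i)}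
  {n p i : ℤ}

lemma mem_induced_grFiltration_iff {e : Coh (A.grCx n) i} :
    e ∈ Coh.induced (A.grCx n) i (A.grFiltration F n p i) ↔ A.FCls F n p i e := by
  constructor
  · rintro ⟨y, ⟨x, hx, hxy⟩, rfl⟩
    have hy : ((A.grCx n).d i (i + 1)).hom (A.grMk n i x x.2) = 0 := by
      rw [show A.grMk n i x x.2 = y from hxy]
      exact y.2
    refine ⟨x, hx, x.2, (A.grMk_eq_zero n _ _ _).1 hy, ?_⟩
    exact congrArg (Submodule.Quotient.mk (p := (coboundaries (A.grCx n) i).comap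
      (cocycles (A.grCx n) i).subtype)) (Subtype.ext hxy.symm)
  · rintro ⟨x, hx, hxW, hdx, rfl⟩
    exact ⟨⟨A.grMk n i x hxW, by
      change ((A.grCx n).d i (i + 1)).hom (A.grMk n i x hxW) = 0
      rw [FiltCx.d_grMk, FiltCx.grMk_eq_zero]
      exact hdx⟩, ⟨⟨x, hxW⟩, hx, rfl⟩, rfl⟩

lemma mem_coh_induced_iff {h : Coh A.cx.obj i} :
    h ∈ Coh.induced A.cx.obj i (F p i) ↔ A.FCoh F p i h := by
  constructor
  · rintro ⟨x, hx, rfl⟩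
    exact ⟨x, x.2, hx, rfl⟩
  · rintro ⟨x, hx, hxF, rfl⟩
    exact ⟨⟨x, hx⟩, hxF, rfl⟩

end FiltrationF

/-! ### Application to an infinite mixed Hodge complex. -/

namespace InfiniteMixedHodgeComplex

variable (M : InfiniteMixedHodgeComplex.{u}) {n m p i j : ℤ}

/-- The isomorphism `ℂ ⊗ H^i(gr^W_n K) ≃ H^i(gr^W_n K_ℂ)`. -/
def grCompare (n i : ℤ) : ℂ ⊗[ℚ] Coh (M.K.grCx n) i ≃ₗ[ℂ] Coh (M.KC.grCx n) i :=
  comparison (DPlus.Q.mapIso (grComplexIso M.K n) ≪≫ (DPlusF.gr n).mapIso M.α) i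

/-- The isomorphism `ℂ ⊗ H^i(K) ≃ H^i(K_ℂ)`. -/
def compare (i : ℤ) : ℂ ⊗[ℚ] M.H i ≃ₗ[ℂ] Coh M.KC.cx.obj i := comparison M.αForget i

lemma grCompare_apply (t : ℂ ⊗[ℚ] Coh (M.K.grCx n) i) :
    M.grCompare n i t = DPlusF.grCohMap M.α.hom n i (grCohComplexMap M.K n i t) :=
  (DPlus.cohEquiv_trans _ _ i _).trans (congrArg (DPlus.cohEquiv ((DPlusF.gr n).mapIso M.α) i)
    (DPlus.cohEquiv_mapIso (grComplexIso M.K n) i (cohComplexEquiv (M.K.grCx n) i t)))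

lemma compare_apply (t : ℂ ⊗[ℚ] M.H i) :
    M.compare i t = DPlusF.cohMap M.α.hom i (cohComplexEquiv M.K.cx.obj i t) := rfl

/-- Complex conjugation on `H^i(gr^W_n K_ℂ)`. -/
def grConj (n i : ℤ) : Coh (M.KC.grCx n) i →+ Coh (M.KC.grCx n) i :=
  (M.grCompare n i).toLinearMap.toAddMonoidHom.comp
    ((conjugation _).toAddMonoidHom.comp (M.grCompare n i).symm.toLinearMap.toAddMonoidHom)

/-- Complex conjugation on `H^i(K_ℂ)`. -/
def cohConj (i : ℤ) : Coh M.KC.cx.obj i →+ Coh M.KC.cx.obj i :=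
  (M.compare i).toLinearMap.toAddMonoidHom.comp
    ((conjugation _).toAddMonoidHom.comp (M.compare i).symm.toLinearMap.toAddMonoidHom)

lemma grConj_grCompare (t : ℂ ⊗[ℚ] Coh (M.K.grCx n) i) :
    M.grConj n i (M.grCompare n i t) = M.grCompare n i (conjugation _ t) :=
  congrArg (fun s => M.grCompare n i (conjugation _ s)) ((M.grCompare n i).symm_apply_apply t)

lemma cohConj_compare (t : ℂ ⊗[ℚ] M.H i) :
    M.cohConj i (M.compare i t) = M.compare i (conjugation _ t) :=
  congrArg (fun s => M.compare i (conjugation _ s)) ((M.compare i).symm_apply_apply t)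

/-- The relation is carried through $\alpha$ to $\mathbb C\otimes K$, conjugated there on cochains,
and carried back. -/
lemma dRel_grConj (hij : i + 1 = j) (hmn : m < n) {e : Coh (M.KC.grCx n) i}
    {u : Coh (M.KC.grCx m) j} (h : M.KC.DRel n m i j e u) :
    M.KC.DRel n m i j (M.grConj n i e) (M.grConj m j u) := by
  obtain ⟨t, rfl⟩ := (M.grCompare n i).surjective e
  obtain ⟨s, rfl⟩ := (M.grCompare m j).surjective u
  rw [grConj_grCompare, grConj_grCompare]
  rw [grCompare_apply, grCompare_apply] at h ⊢
  exact (DPlusF.dRel_map_iff M.α hij hmn).2 (dRel_conj ((DPlusF.dRel_map_iff M.α hij hmn).1 h))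

lemma rRel_conj {h : Coh M.KC.cx.obj i} {e : Coh (M.KC.grCx n) i} (H : M.KC.RRel n i h e) :
    M.KC.RRel n i (M.cohConj i h) (M.grConj n i e) := by
  obtain ⟨t, rfl⟩ := (M.grCompare n i).surjective e
  obtain ⟨s, rfl⟩ := (M.compare i).surjective h
  rw [grConj_grCompare, cohConj_compare]
  rw [grCompare_apply, compare_apply] at H ⊢
  exact (DPlusF.rRel_map_iff M.α).2 (InfHodge.rRel_conj ((DPlusF.rRel_map_iff M.α).1 H))

/-- The filtration induced by `F` on `ℂ ⊗ H^i(gr^W_n K)`. -/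
def grHodge (n i p : ℤ) : Submodule ℂ (ℂ ⊗[ℚ] Coh (M.K.grCx n) i) :=
  hodgeFiltration (DPlus.Q.mapIso (grComplexIso M.K n) ≪≫ (DPlusF.gr n).mapIso M.α)
    (M.KC.grFiltration M.F n) i p

lemma mem_grHodge_iff {t : ℂ ⊗[ℚ] Coh (M.K.grCx n) i} :
    t ∈ M.grHodge n i p ↔ M.KC.FCls M.F n p i (M.grCompare n i t) :=
  mem_induced_grFiltration_iff

lemma grHodge_isCompl (n i p : ℤ) :
    IsCompl (M.grHodge n i p) (conjFiltration (M.grHodge n i) (n + i + 1 - p)) :=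
  ((M.gr n).hodge i).isCompl p

lemma mem_hodge_iff {t : ℂ ⊗[ℚ] M.H i} :
    t ∈ M.hodge i p ↔ M.KC.FCoh M.F p i (M.compare i t) :=
  mem_coh_induced_iff

lemma isPure : M.KC.IsPure M.F M.grConj where
  biregular := M.F_biregular
  strict := by
    intro n p i j hij y z hyF hy hz hyz
    subst hij
    have h1 : M.KC.grMk n (i + 1) y hy ∈
        LinearMap.range ((M.KC.grCx n).d i (i + 1)).hom ⊓ M.KC.grFiltration M.F n p (i + 1) :=
      ⟨⟨M.KC.grMk n i z hz, ((M.KC.grMk_eq n _ _ _ _ _).2 hyz).symm⟩, ⟨⟨y, hy⟩, hyF, rfl⟩⟩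
    obtain ⟨_, ⟨z', hzF', rfl⟩, hz'⟩ := (M.gr n).strict p i h1
    refine ⟨z', hzF', z'.2, ?_⟩
    exact (M.KC.grMk_eq n (i + 1) y hy _ (M.KC.biregular.map_d n i (i + 1) z'.2)).1 hz'.symm
  invol n i e := by
    obtain ⟨t, rfl⟩ := (M.grCompare n i).surjective e
    rw [grConj_grCompare, grConj_grCompare, conjugation_conjugation]
  dRel hij hmn _ _ h := M.dRel_grConj hij hmn h
  split := by
    intro n a b i hab e
    obtain ⟨t, rfl⟩ := (M.grCompare n i).surjective e
    obtain rfl : b = n + i + 1 - a := by omega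
    obtain ⟨f, hf, g, hg, rfl⟩ := Submodule.mem_sup.1
      ((M.grHodge_isCompl n i a).codisjoint.eq_top ▸ Submodule.mem_top (x := t))
    refine ⟨_, _, map_add _ _ _, M.mem_grHodge_iff.1 hf, ?_⟩
    rw [grConj_grCompare]
    exact M.mem_grHodge_iff.1 hg
  disjoint := by
    intro n a b i hab e ha hb
    obtain ⟨t, rfl⟩ := (M.grCompare n i).surjective e
    obtain rfl : b = n + i + 1 - a := by omega
    rw [grConj_grCompare] at hb
    have := Submodule.disjoint_def.1 (M.grHodge_isCompl n i a).disjoint t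
      (M.mem_grHodge_iff.2 ha) (M.mem_grHodge_iff.2 hb)
    rw [this, map_zero]

lemma wCoh_compare_iff (t : ℂ ⊗[ℚ] M.H i) :
    M.KC.WCoh (n - i) i (M.compare i t) ↔ t ∈ (M.K.decCoh i n).baseChange ℂ := by
  rw [← wCoh_complexify_iff, compare_apply]
  exact DPlusF.wCoh_map_iff M.α

lemma degeneratesAt : M.K.DegeneratesAt 2 :=
  degeneratesAt_two fun hij hmn _ hx hdx => exists_d_eq_of_complexify
    (fun r hr => DPlusF.deg_of_iso M.α (by omega) (M.isPure.deg hr)) hij hmn hx hdx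

lemma isInfiniteMixedHodgeStructure (i : ℤ) :
    IsInfiniteMixedHodgeStructure (V := M.H i) (M.K.decCoh i) (M.hodge i) := by
  have hmono : Monotone (M.K.decCoh i) := fun a b hab =>
    Submodule.map_mono (Submodule.comap_mono (M.K.biregular.mono i _ _ (by omega)))
  have hanti : Antitone (M.hodge i) := fun a b hab =>
    Submodule.comap_mono (Submodule.map_mono (Submodule.comap_mono
      (M.F_biregular.anti i _ _ hab)))
  have hfin : ∃ a b : ℤ, M.hodge i a = ⊤ ∧ M.hodge i b = ⊥ := by
    obtain ⟨a, b, ha, hb⟩ := M.F_biregular.finite i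
    refine ⟨a, b, eq_top_iff.2 fun t _ => M.mem_hodge_iff.2 ?_, eq_bot_iff.2 fun t ht => ?_⟩
    · obtain ⟨x, hx, h⟩ := Coh.mk_surj _ _ (M.compare i t)
      exact ⟨x, hx, by rw [ha]; trivial, h⟩
    · obtain ⟨x, hx, hxF, h⟩ := M.mem_hodge_iff.1 ht
      rw [hb, Submodule.mem_bot] at hxF
      subst hxF
      have h0 : M.compare i t = 0 := h.trans ((Coh.mk_eq_zero _ _ _ _).2 ⟨0, map_zero _⟩)
      exact (M.compare i).map_eq_zero_iff.1 h0
  refine ⟨hmono, ?_, hanti, hfin, fun n => ?_⟩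
  · obtain ⟨a, b, ha, hb⟩ := M.K.biregular.finite i
    refine ⟨a + i, b + i, ?_, ?_⟩
    · rw [eq_bot_iff]
      rintro _ ⟨x, hx, rfl⟩
      have hx' : (x : M.K.cx.obj.X i) ∈ M.K.W (a + i - i) i := hx
      rw [add_sub_cancel_right, ha, Submodule.mem_bot] at hx'
      obtain rfl : x = 0 := Subtype.ext hx'
      rw [map_zero]
      exact zero_mem _
    · rw [eq_top_iff]
      rintro y -
      obtain ⟨x, hx, rfl⟩ := Coh.mk_surj _ _ y
      refine ⟨⟨x, hx⟩, ?_, rfl⟩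
      change x ∈ M.K.W (b + i - i) i
      rw [add_sub_cancel_right, hb]
      trivial
  · refine isInfiniteHodgeStructure_of_isCompl (inducedGr_antitone hanti) ?_ fun p => ?_
    · obtain ⟨a, b, ha, hb⟩ := hfin
      exact ⟨a, b, inducedGr_eq_top ha, inducedGr_eq_bot hb⟩
    · have hτ (h : Coh M.KC.cx.obj i) : M.cohConj i (M.cohConj i h) = h := by
        obtain ⟨t, rfl⟩ := (M.compare i).surjective h
        rw [cohConj_compare, cohConj_compare, conjugation_conjugation]
      have hR : ∀ n h e, M.KC.RRel n i h e → M.KC.RRel n i (M.cohConj i h) (M.grConj n i e) :=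
        fun _ _ _ => M.rRel_conj
      have hn : n - 1 - i = n - i - 1 := by omega
      have hconj (q : ℤ) (t : ℂ ⊗[ℚ] M.H i) : t ∈ conjFiltration (M.hodge i) q ↔
          M.KC.FCoh M.F q i (M.cohConj i (M.compare i t)) := by
        rw [cohConj_compare]
        exact M.mem_hodge_iff
      refine inducedGr_isCompl (hmono (by omega)) ?_ ?_
      · intro t ht
        -- Here the index of $W$ is $n-i$, so complementary indices add up to $(n-i)+i+1=n+1$: the
        -- shift in $\mathrm{Dec}(W)$ gives weight $n$.
        obtain ⟨h₁, h₂, hF₁, hW₁, hF₂, hW₂, h⟩ := M.isPure.coh_split hτ hR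
          (a := p) (b := n + 1 - p) (by omega) ((M.wCoh_compare_iff t).2 ht)
        obtain ⟨t₁, rfl⟩ := (M.compare i).surjective h₁
        obtain ⟨t₂, rfl⟩ := (M.compare i).surjective h₂
        rw [← map_sub, ← map_sub, ← hn] at h
        exact ⟨t₁, M.mem_hodge_iff.2 hF₁, t₂, (hconj _ _).2 hF₂, (M.wCoh_compare_iff _).1 hW₁,
          (M.wCoh_compare_iff _).1 hW₂, (M.wCoh_compare_iff _).1 h⟩
      · intro t₁ hF₁ t₂ hF₂ hW₁ hW₂ h
        rw [← wCoh_compare_iff] at hW₁ hW₂ h ⊢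
        rw [map_sub] at h
        rw [hn] at h ⊢
        exact M.isPure.coh_disjoint hτ hR (a := p) (b := n + 1 - p) (by omega)
          (M.mem_hodge_iff.1 hF₁) hW₁ ((hconj _ _).1 hF₂) hW₂ h

end InfiniteMixedHodgeComplex

end InfHodge

end

theorem mainTheorem8 (M : InfHodge.InfiniteMixedHodgeComplex.{u}) :
    (∀ i : ℤ, InfHodge.IsInfiniteMixedHodgeStructure (V := M.H i) (M.K.decCoh i) (M.hodge i)) ∧
      M.K.DegeneratesAt 2 :=
  ⟨M.isInfiniteMixedHodgeStructure, M.degeneratesAt⟩
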